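/- **Setting.** Let $\mathcal S\subset\mathbb Z$ be finite with $S=|\mathcal S|$, enumerated as $\{x(0),\dots,x(S-1)\}$, and let $\{X(t):t\ge 0\}$ be a time-homogeneous continuous-time Markov chain on $\mathcal S$ with right-continuous paths: for $s,t\ge0$, $\mathbb P[X(s+t)=l\mid X(s)=k,\ X(u):0\le u<s]=\mathbb P[X(s+t)=l\mid X(s)=k]=P_t(k,l)$, where $(P_t)_{t\ge 0}$ is a standard transition function (stochastic matrices, $P_0=I$, $P_{s+t}=P_sP_t$, continuous at $0$). Let $\lambda_k=-\frac{d}{dt}P_t(k,k)\big|_{t=0+}$ be the rate of leaving the state $k$ and assume $\lambda_{\min}=\min_k\lambda_k>0$. Let $X_1,X_2,\dots$ be the successive states visited by the path and $\tau_1,\tau_2,\dots$ their holding times. Let $0<\epsilon<1$, $n\in\mathbb N$, $\log=\log_2$, and put $$s=\lceil\log S\rceil,\qquad m=\max\Big\{0,\Big\lceil\log\Big(-\tfrac{\ln\epsilon}{\lambda_{\min}}\Big)\Big\rceil\Big\},\qquad T=2^m .$$ For $\mathbf k\in\{0,\dots,S-1\}^n$ and $\mathbf t\in\{0,\dots,T-1\}^n$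 let $H_j$ be the event that $X_i=x(k_i)$ and $t_i\le\tau_i<t_i+1$ for all $i<j$, and let $$p(\mathbf k,\mathbf t)=\prod_{j=1}^n\sqrt{\mathbb P[X_j=x(k_j)\mid H_j]}\;\sqrt{\mathbb P[t_j\le\tau_j<t_j+1\mid H_j,\ X_j=x(k_j),\ \tau_j<T]}$$ (conditional probabilities given null events are read as $0$). **Circuits.** A gate is a (multi-)controlled one-qubit rotation $|0\rangle\mapsto\cos\theta|0\rangle+\sin\theta|1\rangle$, $|1\rangle\mapsto-\sin\theta|0\rangle+\cos\theta|1\rangle$, with any number of control qubits (possibly none), each required to be in a prescribed basis state. A layer consists of gates with distinct targets none of which is a control of another gate of the layer (control qubits may be shared). The depth is the number of layers. **Theorem (Continuous Markov process' preparation).** There is a universal constant $C$ such that, for all such data, the following hold. 1. Given $X_j=k$ (where this event has positive probability), $\mathbb P[\tau_j\ge t\mid X_j=k]=e^{-\lambda_k t}$ for all $t\ge0$. Truncating holding times to $[0,T)$ has error at most $\epsilon$: $\mathbb P[\tau_j\ge T\mid X_j=k]\le\epsilon$ for all $1\le j\le n$ and all such $k$. Moreover $\sum_{\mathbf k,\mathbf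 t}p(\mathbf k,\mathbf t)^2=1$. 2. There is a circuit, without ancilla qubits, on $$N=n\lceil\log S\rceil+n\max\Big\{0,\Big\lceil\log\Big(-\tfrac{\ln\epsilon}{\lambda_{\min}}\Big)\Big\rceil\Big\}$$ qubits which maps $|0\cdots0\rangle$ exactly to $\sum_{\mathbf k,\mathbf t}p(\mathbf k,\mathbf t)\,|\mathbf k,\mathbf t\rangle$, where each $k_j$ is written in binary on $s$ qubits and each $t_j$ on $m$ qubits. It has at most $C\,nS\,(S+m)$ gates and depth at most $nS^2$. 3. If $-\ln\epsilon/\lambda_{\min}\ge1$, then $m=\lceil\log(-\ln\epsilon/\lambda_{\min})\rceil$, so the number of gates is $O\big(nS\lceil S+\log(-\frac{\ln\epsilon}{\lambda_{\min}})\rceil\big)$, and $N\le n\big(\lceil\log(-\frac{S}{\lambda_{\min}}\ln\epsilon)\rceil+1\big)$; if in addition $S$ is a power of two, then $N=n\lceil\log(-\frac{S}{\lambda_{\min}}\ln\epsilon)\rceil$. -/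

import Mathlib

open MeasureTheory ProbabilityTheory
open scoped NNReal ENNReal Matrix

noncomputable section

namespace QCTSP

/-! ### Quantum circuits of multi-controlled rotations -/

/-- A multi-controlled `Y`-rotation on qubits labelled by `Q`: when every qubit `q ∈ controls` is
in the basis state `pattern q`, the target is rotated by
`|0⟩ ↦ cos θ |0⟩ + sin θ |1⟩`, `|1⟩ ↦ -sin θ |0⟩ + cos θ |1⟩`; otherwise nothing happens.
With no controls it is a plain rotation. -/
structure Gate (Q : Type*) where
  controls : Finset Q
  pattern : Q → Bool
  target : Q
  angle : ℝ
  target_notMem : target ∉ controls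

/-- The entry `⟨a| R(θ) |b⟩` of the one-qubit rotation. -/
def rotEntry (θ : ℝ) (a b : Bool) : ℂ :=
  if a = b then (Real.cos θ : ℂ) else if a then (Real.sin θ : ℂ) else -(Real.sin θ : ℂ)

namespace Gate

variable {Q : Type*} [DecidableEq Q]

/-- The basis state `b` satisfies all the controls. -/
def Fires (g : Gate Q) (b : Q → Bool) : Prop := ∀ q ∈ g.controls, b q = g.pattern q

instance (g : Gate Q) (b : Q → Bool) : Decidable (g.Fires b) := by
  unfold Fires; infer_instance

theorem fires_update (g : Gate Q) (b : Q → Bool) (v : Bool) :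
    g.Fires (Function.update b g.target v) ↔ g.Fires b := by
  unfold Fires
  refine forall₂_congr fun q hq => ?_
  rw [Function.update_of_ne]
  rintro rfl
  exact g.target_notMem hq

variable [Fintype Q]

/-- The matrix of the gate in the computational basis. -/
def matrix (g : Gate Q) : Matrix (Q → Bool) (Q → Bool) ℂ := fun a b =>
  if g.Fires b then
    if Function.update b g.target (a g.target) = a then
      rotEntry g.angle (a g.target) (b g.target)
    else 0
  else if a = b then 1 else 0

theorem sum_star_matrix_mul (g : Gate Q) (a : Q → Bool) (f : (Q → Bool) → ℂ) :
    ∑ b, star (g.matrix b a) * f b =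
      if g.Fires a then
        ∑ v : Bool, star (rotEntry g.angle v (a g.target)) * f (Function.update a g.target v)
      else f a := by
  by_cases h : g.Fires a
  · rw [if_pos h]
    symm
    refine Finset.sum_of_injOn (fun v => Function.update a g.target v) ?_ ?_ ?_ ?_
    · intro v _ w _ hvw
      simpa using congrFun hvw g.target
    · intro v _
      simp
    · intro b _ hb
      have hne : Function.update a g.target (b g.target) ≠ b := by
        intro hE
        exact hb ⟨b g.target, by simp, hE⟩
      simp [matrix, h, hne]
    · intro v _
      simp [matrix, h]
  · rw [if_neg h, Finset.sum_eq_single a]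
    · simp [matrix, h]
    · intro b _ hb
      simp [matrix, h, hb]
    · simp

theorem matrix_unitary (g : Gate Q) : g.matrix ∈ Matrix.unitaryGroup (Q → Bool) ℂ := by
  rw [Matrix.mem_unitaryGroup_iff']
  ext a c
  rw [Matrix.mul_apply]
  simp only [Matrix.star_apply]
  rw [sum_star_matrix_mul g a (fun b => g.matrix b c)]
  have hcs : (Complex.cos g.angle) ^ 2 + (Complex.sin g.angle) ^ 2 = 1 := by
    rw [add_comm]; exact Complex.sin_sq_add_cos_sq _
  by_cases ha : g.Fires a
  · rw [if_pos ha]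
    by_cases hc : g.Fires c
    · by_cases hac : ∀ q, q ≠ g.target → c q = a q
      · have hu : ∀ v, Function.update c g.target v = Function.update a g.target v := by
          intro v
          ext q
          by_cases hq : q = g.target
          · subst hq; simp
          · simp [Function.update_of_ne hq, hac q hq]
        have heq : a = c ↔ a g.target = c g.target := by
          refine ⟨fun h => h ▸ rfl, fun h => funext fun q => ?_⟩
          by_cases hq : q = g.target
          · rw [hq, h]
          · exact (hac q hq).symm
        rw [Matrix.one_apply]
        simp only [matrix, hc, if_true, Function.update_self, hu, heq, Fintype.sum_bool]
        cases h1 : a g.target <;> cases h2 : c g.target <;>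
          simp [rotEntry, ← Complex.cos_conj, ← Complex.sin_conj] <;>
              first | ring1 | linear_combination hcs
      · have hne : ∀ v, Function.update c g.target v ≠ Function.update a g.target v := by
          intro v h
          apply hac
          intro q hq
          have := congrFun h q
          simpa [Function.update_of_ne hq] using this
        have hne2 : a ≠ c := by
          rintro rfl
          exact hac fun _ _ => rfl
        simp [matrix, hc, hne, Matrix.one_apply_ne hne2]
    · have hne : ∀ v, Function.update a g.target v ≠ c := by
        rintro v rfl
        exact hc ((g.fires_update a v).2 ha)
      have hne2 : a ≠ c := by
        rintro rfl
        exact hc ha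
      simp [matrix, hc, hne, Matrix.one_apply_ne hne2]
  · rw [if_neg ha]
    by_cases hc : g.Fires c
    · have hne : Function.update c g.target (a g.target) ≠ a := by
        intro h
        apply ha
        rw [← h]
        exact (g.fires_update c _).2 hc
      have hne2 : a ≠ c := by
        rintro rfl
        exact ha hc
      simp [matrix, hc, hne, Matrix.one_apply_ne hne2]
    · simp [matrix, hc, Matrix.one_apply]

/-- The gate as a unitary operator. -/
def unitary (g : Gate Q) : Matrix.unitaryGroup (Q → Bool) ℂ := ⟨g.matrix, g.matrix_unitary⟩

/-- Two gates may be executed in the same time step: neither acts on a qubit used by the other,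
except that both may read the same control qubits. -/
def Compatible (g h : Gate Q) : Prop :=
  g.target ≠ h.target ∧ g.target ∉ h.controls ∧ h.target ∉ g.controls

end Gate

/-- A circuit: a finite sequence of layers (first layer first), each consisting of pairwise
compatible gates. -/
structure Circuit (Q : Type*) [Fintype Q] [DecidableEq Q] where
  layers : List (List (Gate Q))
  compatible : ∀ L ∈ layers, L.Pairwise Gate.Compatible

namespace Circuit

variable {Q : Type*} [Fintype Q] [DecidableEq Q]

/-- The number of layers. -/
def depth (c : Circuit Q) : ℕ := c.layers.length

/-- The total number of gates. -/
def gateCount (c : Circuit Q) : ℕ := (c.layers.map List.length).sum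

/-- The unitary operator implemented by the circuit; the first layer acts first. -/
def unitary (c : Circuit Q) : Matrix.unitaryGroup (Q → Bool) ℂ :=
  (c.layers.flatten.map Gate.unitary).reverse.prod

end Circuit

/-- The computational basis vector `|b⟩`. -/
def ket {Q : Type*} [Fintype Q] [DecidableEq Q] (b : Q → Bool) : (Q → Bool) → ℂ := Pi.single b 1

/-- The qubits of `n` pieces: the `j`-th piece has `s` state qubits `(j, inl i)` and
`m` time qubits `(j, inr i)`. -/
abbrev Qubits (n s m : ℕ) : Type := Fin n × (Fin s ⊕ Fin m)

/-- The number `⌈log₂ S⌉` of state qubits of a piece. -/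
def stateQubits (S : ℕ) : ℕ := ⌈Real.logb 2 S⌉₊

/-- The number `⌈log₂ (-(1 / lam) ln ε)⌉` of time qubits of a piece
(`0` if this is negative, i.e. if a single time slice is more than enough). -/
def timeQubits (lam ε : ℝ) : ℕ := ⌈Real.logb 2 (-(1 / lam) * Real.log ε)⌉₊

/-- The bit string of the pair of sequences `(k, t)`: in the `j`-th piece the indices
`k j` and `t j` are written in binary, the `i`-th qubit holding the bit of weight `2 ^ i`. -/
def encode {n : ℕ} (s m : ℕ) (k t : Fin n → ℕ) : Qubits n s m → Bool
  | (j, Sum.inl i) => (k j).testBit i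
  | (j, Sum.inr i) => (t j).testBit i

/-! ### Continuous-time Markov chains -/

section Markov

/-- A standard transition function on a finite state space. -/
structure IsTransitionFunction {E : Type*} [Fintype E] [DecidableEq E]
    (P : ℝ≥0 → Matrix E E ℝ) : Prop where
  nonneg : ∀ t k l, 0 ≤ P t k l
  row_sum : ∀ t k, ∑ l, P t k l = 1
  zero : P 0 = 1
  add : ∀ s t, P (s + t) = P s * P t
  continuousAt_zero : ∀ k l, ContinuousAt (fun t => P t k l) 0

/-- The rate `λ_k = - d/dt P_t(k, k) |_{t = 0+}` at which the state `k` is left. -/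
def exitRate {E : Type*} (P : ℝ≥0 → Matrix E E ℝ) (k : E) : ℝ :=
  -derivWithin (fun t : ℝ => P t.toNNReal k k) (Set.Ici 0) 0

/-- The minimum `λ_min` of the rates over the (finite) state space. -/
def minRate {E : Type*} (P : ℝ≥0 → Matrix E E ℝ) : ℝ := ⨅ k, exitRate P k

/-- The σ-algebra generated by `X u`, `u < s`. -/
abbrev past {Ω E : Type*} [MeasurableSpace E] (X : ℝ≥0 → Ω → E) (s : ℝ≥0) : MeasurableSpace Ω :=
  ⨆ u : Set.Iio s, MeasurableSpace.comap (X u) inferInstance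

/-- `X` is a (time-homogeneous) continuous-time Markov chain with right-continuous paths on the
finite discrete space `E`, with transition function `P`. -/
structure IsMarkovChain {Ω E : Type*} [MeasurableSpace Ω] [Fintype E] [DecidableEq E]
    [MeasurableSpace E] [TopologicalSpace E]
    (μ : Measure Ω) (P : ℝ≥0 → Matrix E E ℝ) (X : ℝ≥0 → Ω → E) : Prop where
  measurable : ∀ t, Measurable (X t)
  right_continuous : ∀ ω t, ContinuousWithinAt (fun s => X s ω) (Set.Ici t) t
  transitionFunction : IsTransitionFunction P
  /-- `ℙ[X(s+t) = l | X(s) = k ∧ past] = ℙ[X(s+t) = l | X(s) = k]`. -/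
  markov : ∀ (s t : ℝ≥0) (k l : E) (A : Set Ω), MeasurableSet[past X s] A →
    μ ({ω | X s ω = k} ∩ A) ≠ 0 →
      (ProbabilityTheory.cond μ ({ω | X s ω = k} ∩ A)).real {ω | X (s + t) ω = l} =
        (ProbabilityTheory.cond μ {ω | X s ω = k}).real {ω | X (s + t) ω = l}
  /-- `ℙ[X(s+t) = l | X(s) = k] = P_t(k, l)`. -/
  transition : ∀ (s t : ℝ≥0) (k l : E), μ {ω | X s ω = k} ≠ 0 →
    (ProbabilityTheory.cond μ {ω | X s ω = k}).real {ω | X (s + t) ω = l} = P t k l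

/-- How long the path `f` keeps the value it has at time `t` (`∞` if it never leaves it). -/
def holdFrom {E : Type*} (f : ℝ≥0 → E) (t : ℝ≥0) : ℝ≥0∞ :=
  sInf ((fun h : ℝ≥0 => (h : ℝ≥0∞)) '' {h | f (t + h) ≠ f t})

/-- The time at which the `j`-th piece of the path begins (pieces are numbered from `0`). -/
def jumpTime {E : Type*} (f : ℝ≥0 → E) : ℕ → ℝ≥0∞
  | 0 => 0
  | j + 1 => jumpTime f j + holdFrom f (jumpTime f j).toNNReal

/-- The value of the path on its `j`-th piece. -/
def pieceState {E : Type*} (f : ℝ≥0 → E) (j : ℕ) : E := f (jumpTime f j).toNNReal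

/-- The length of the `j`-th piece of the path. -/
def holdingTime {E : Type*} (f : ℝ≥0 → E) (j : ℕ) : ℝ≥0∞ := holdFrom f (jumpTime f j).toNNReal

variable {Ω E : Type*} [MeasurableSpace Ω]

/-- The event `X_j = k`. -/
def stateEvent (X : ℝ≥0 → Ω → E) (j : ℕ) (k : E) : Set Ω :=
  {ω | pieceState (fun u => X u ω) j = k}

/-- The event `t ≤ τ_j < t + 1`, i.e. the `j`-th piece ends in its time slice number `t`. -/
def sliceEvent (X : ℝ≥0 → Ω → E) (j t : ℕ) : Set Ω :=
  {ω | (t : ℝ≥0∞) ≤ holdingTime (fun u => X u ω) j ∧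
    holdingTime (fun u => X u ω) j < (t : ℝ≥0∞) + 1}

/-- The event `τ_j < T`. -/
def truncEvent (X : ℝ≥0 → Ω → E) (j T : ℕ) : Set Ω :=
  {ω | holdingTime (fun u => X u ω) j < (T : ℝ≥0∞)}

/-- The event that the pieces before the `j`-th one are given by `(k, t)`. -/
def historyEvent (X : ℝ≥0 → Ω → E) {n : ℕ} (k : Fin n → E) (t : Fin n → ℕ) (j : Fin n) : Set Ω :=
  {ω | ∀ i, i < j → ω ∈ stateEvent X i (k i) ∩ sliceEvent X i (t i)}

/-- The amplitude `p(k, t)`, the product over the pieces of the square roots of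
`ℙ[X_j = k_j | history]` and of `ℙ[t_j ≤ τ_j < t_j + 1 | history, X_j = k_j, τ_j < T]`
(the law of the holding time truncated to `[0, T)`). -/
def amplitude (μ : Measure Ω) (X : ℝ≥0 → Ω → E) (T : ℕ) {n : ℕ}
    (k : Fin n → E) (t : Fin n → ℕ) : ℝ :=
  ∏ j : Fin n,
    (Real.sqrt ((ProbabilityTheory.cond μ (historyEvent X k t j)).real (stateEvent X j (k j))) *
      Real.sqrt ((ProbabilityTheory.cond μ
        (historyEvent X k t j ∩ stateEvent X j (k j) ∩ truncEvent X j T)).real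
          (sliceEvent X j (t j))))

end Markov

/-- The state `∑_{k, t} p(k, t) |k, t⟩` of `n` pieces with holding times truncated to
`[0, 2 ^ m)`, the state space being enumerated by `x`. -/
def targetState {Ω E : Type*} [MeasurableSpace Ω] (μ : Measure Ω) (X : ℝ≥0 → Ω → E)
    {S : ℕ} (x : Fin S ≃ E) (n s m : ℕ) : (Qubits n s m → Bool) → ℂ :=
  ∑ k : Fin n → Fin S, ∑ t : Fin n → Fin (2 ^ m),
    ((amplitude μ X (2 ^ m) (fun j => x (k j)) (fun j => (t j : ℕ)) : ℝ) : ℂ) •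
      ket (encode s m (fun j => (k j : ℕ)) (fun j => (t j : ℕ)))

end QCTSP

end

/-! The probabilistic half is the jump-chain description of a finite Markov chain, derived from the
Markov property at deterministic times alone. Sample the path on a grid of mesh h. Leaving k for l
at a grid time that is at least t, and then following a given itinerary, is a disjoint union of
cylinder events. A geometric series gives it the mass P_h(k,k)^(⌈t/h⌉-1) · P_h(k,l)/(1-P_h(k,k)),
times the initial mass of k and the weight of the itinerary (`HasMarkovLaw.real_exists_gridExit`).
For each right-continuous path the grid event eventually coincides with the true first-exit event
(`eventually_gridExit_iff`), so these masses converge. The first factor tends to exp(-λ_k t);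
convergence of the whole then forces that of the second, whose limit is the jump probability
(`HasMarkovLaw.real_firstExit`).

Hence, given the initial state, the holding time is exponential and independent of the next state,
and the process restarted at its first jump has the same transition law, even after restriction to a
time slice (`HasMarkovLaw.restrict_sliceSet`). Iteration turns the amplitude into a product over
pieces of square roots of entry probabilities, depending only on the previous state, and of
truncated exponential slice masses (`HasMarkovLaw.amplitude_eq`).

The circuit follows this product piece by piece. A real nonnegative superposition of S basis states
costs S-1 controlled rotations, each splitting one new index off an old one
(`exists_prepare_range`); this is done once for each possible previous state. With y = exp(-λ_k),
the identity 1-y^(2^m) = (1-y)∏(1+y^(2^i)) makes the binary digits of the time slice independent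
(`sliceProb_two_pow`), so for each current state one layer of m rotations prepares the time
register. A piece thus takes at most S(S-1)+Sm gates and S(S-1)+S = S² layers. -/

noncomputable section

namespace QCTSP

open Filter Topology

/-! ### Right-continuous paths in a discrete space and their sampling on fine grids -/

section Paths

variable {E : Type*}

/-- The path `f`, observed after the successive time increments of `L` from time `t` on,
visits the prescribed states. -/
def Follows (f : ℝ≥0 → E) : ℝ≥0 → List (ℝ≥0 × E) → Prop
  | _, [] => True
  | t, p :: L => f (t + p.1) = p.2 ∧ Follows f (t + p.1) L

/-- The probability that a chain with transition function `P` started at `k` follows `L`. -/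
def pathWeight (P : ℝ≥0 → Matrix E E ℝ) : E → List (ℝ≥0 × E) → ℝ
  | _, [] => 1
  | k, p :: L => P p.1 k p.2 * pathWeight P p.2 L

/-- The path seen from its first jump on. -/
def restart (f : ℝ≥0 → E) : ℝ≥0 → E := fun u => f ((holdFrom f 0).toNNReal + u)

theorem follows_shift (f : ℝ≥0 → E) (a : ℝ≥0) (L : List (ℝ≥0 × E)) (v : ℝ≥0) :
    Follows (fun u => f (a + u)) v L ↔ Follows f (a + v) L := by
  induction L generalizing v with
  | nil => simp [Follows]
  | cons p L ih => simp only [Follows, ih, add_assoc]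

theorem follows_replicate_append (f : ℝ≥0 → E) (h : ℝ≥0) (k : E) (L : List (ℝ≥0 × E))
    (i : ℕ) (t : ℝ≥0) :
    Follows f t (List.replicate i (h, k) ++ L) ↔
      (∀ j < i, f (t + (j + 1) * h) = k) ∧ Follows f (t + i * h) L := by
  induction i generalizing t with
  | zero => simp
  | succ i ih =>
    rw [List.replicate_succ, List.cons_append, Follows, ih, Nat.forall_lt_succ_left]
    have h1 : t + h + (i : ℝ≥0) * h = t + ((i + 1 : ℕ) : ℝ≥0) * h := by push_cast; ring
    have h2 : ∀ j : ℕ, t + h + ((j : ℝ≥0) + 1) * h = t + (((j + 1 : ℕ) : ℝ≥0) + 1) * h := by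
      intro j; push_cast; ring
    simp only [h1, h2, and_assoc]
    simp

variable {f : ℝ≥0 → E}

theorem eq_of_lt_holdFrom {t u : ℝ≥0} (h : (u : ℝ≥0∞) < holdFrom f t) : f (t + u) = f t := by
  by_contra hne
  exact absurd (sInf_le (Set.mem_image_of_mem _ hne)) (not_le.2 h)

theorem le_holdFrom_iff {t u : ℝ≥0} :
    (u : ℝ≥0∞) ≤ holdFrom f t ↔ ∀ v < u, f (t + v) = f t := by
  refine ⟨fun h v hv => eq_of_lt_holdFrom (lt_of_lt_of_le (by exact_mod_cast hv) h), fun h => ?_⟩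
  refine le_sInf ?_
  rintro _ ⟨v, hv, rfl⟩
  by_contra hlt
  exact hv (h v (by simpa using hlt))

variable [TopologicalSpace E]

theorem restart_rightContinuous (hf : ∀ t, ContinuousWithinAt f (Set.Ici t) t) (t : ℝ≥0) :
    ContinuousWithinAt (restart f) (Set.Ici t) t := by
  refine (hf _).comp (f := fun u => (holdFrom f 0).toNNReal + u)
    (continuous_const.add continuous_id).continuousWithinAt ?_
  intro u hu
  exact add_le_add_right (Set.mem_Ici.1 hu) _

variable [DiscreteTopology E]

theorem eventually_eq_right (hf : ∀ t, ContinuousWithinAt f (Set.Ici t) t) (t : ℝ≥0) :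
    ∀ᶠ s in 𝓝[≥] t, f s = f t :=
  hf t ((isOpen_discrete {f t}).mem_nhds rfl)

theorem holdFrom_pos (hf : ∀ t, ContinuousWithinAt f (Set.Ici t) t) (t : ℝ≥0) :
    0 < holdFrom f t := by
  obtain ⟨u, hu, h⟩ := (mem_nhdsGE_iff_exists_Ico_subset).1 (eventually_eq_right hf t)
  have hu : t < u := hu
  refine lt_of_lt_of_le (b := ((u - t : ℝ≥0) : ℝ≥0∞)) (by simpa using hu) ?_
  rw [le_holdFrom_iff]
  intro v hv
  exact h ⟨by simp, by simpa using lt_tsub_iff_left.1 hv⟩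

/-- By right-continuity a value still held at the infimum would persist a little longer, so the
infimum defining a finite holding time is attained. -/
theorem ne_holdFrom (hf : ∀ t, ContinuousWithinAt f (Set.Ici t) t) {t τ : ℝ≥0}
    (h : holdFrom f t = τ) : f (t + τ) ≠ f t := by
  intro heq
  obtain ⟨u, hu, hs⟩ := (mem_nhdsGE_iff_exists_Ico_subset).1 (eventually_eq_right hf (t + τ))
  have hu : t + τ < u := hu
  have : ((u - t : ℝ≥0) : ℝ≥0∞) ≤ holdFrom f t := by
    rw [le_holdFrom_iff]
    intro v hv
    by_cases hvt : v < τ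
    · exact eq_of_lt_holdFrom (by rw [h]; exact_mod_cast hvt)
    · rw [← heq]
      exact hs ⟨by simpa using hvt, by simpa using lt_tsub_iff_left.1 hv⟩
  rw [h] at this
  exact absurd (lt_tsub_iff_left.2 hu) (not_lt.2 (by exact_mod_cast this))

theorem eventually_follows_iff (hf : ∀ t, ContinuousWithinAt f (Set.Ici t) t)
    (L : List (ℝ≥0 × E)) (t : ℝ≥0) :
    ∀ᶠ s in 𝓝[≥] t, (Follows f s L ↔ Follows f t L) := by
  induction L generalizing t with
  | nil => simp [Follows]
  | cons p L ih =>
    have hT : Tendsto (fun s : ℝ≥0 => s + p.1) (𝓝[≥] t) (𝓝[≥] (t + p.1)) := by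
      refine tendsto_nhdsWithin_iff.2 ⟨?_, ?_⟩
      · exact ((continuous_id.add continuous_const).tendsto t).mono_left nhdsWithin_le_nhds
      · filter_upwards [self_mem_nhdsWithin] with s hs
        exact add_le_add_left (Set.mem_Ici.1 hs) _
    filter_upwards [hT.eventually (ih (t + p.1)), hT.eventually (eventually_eq_right hf _)]
      with s h1 h2
    simp only [Follows, h1, h2]

/-- The mesh of the `N`-th time grid. -/
def mesh (N : ℕ) : ℝ≥0 := ((N : ℝ≥0) + 1)⁻¹

theorem mesh_pos (N : ℕ) : 0 < mesh N := by unfold mesh; positivity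

theorem tendsto_mesh : Tendsto mesh atTop (𝓝 0) := by
  have h : Tendsto (fun n : ℕ => 1 / ((n : ℝ) + 1)) atTop (𝓝 0) :=
    tendsto_one_div_add_atTop_nhds_zero_nat
  rw [← NNReal.tendsto_coe]
  refine h.congr fun n => ?_
  simp [mesh]

/-- On the grid of mesh `h` the path starts at `k`, leaves `k` for `l` at a grid time which is at
least `t`, and follows `L` afterwards. -/
def GridExit (h : ℝ≥0) (k l : E) (t : ℝ≥0) (L : List (ℝ≥0 × E)) (f : ℝ≥0 → E) (i : ℕ) : Prop :=
  t ≤ (i + 1) * h ∧ f 0 = k ∧ Follows f 0 (List.replicate i (h, k) ++ (h, l) :: L)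

/-- The path starts at `k`, leaves `k` for `l` at a time which is at least `t`, and follows `L`
afterwards. -/
def FirstExit (k l : E) (t : ℝ≥0) (L : List (ℝ≥0 × E)) (f : ℝ≥0 → E) : Prop :=
  f 0 = k ∧ (t : ℝ≥0∞) ≤ holdFrom f 0 ∧ holdFrom f 0 < ⊤ ∧ restart f 0 = l ∧
    Follows (restart f) 0 L

/-- The first grid point at or after the true jump time τ tends to τ from the right. All finitely
many observations involved are locally constant from the right, so on a fine enough grid they agree
with those made from τ itself. Excursions between grid points are harmless because the grid varies
while the path is fixed. -/
theorem eventually_gridExit_iff (hf : ∀ t, ContinuousWithinAt f (Set.Ici t) t) {k l : E}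
    (hkl : l ≠ k) (t : ℝ≥0) (L : List (ℝ≥0 × E)) :
    ∀ᶠ N in atTop, ((∃ i, GridExit (mesh N) k l t L f i) ↔ FirstExit k l t L f) := by
  by_cases htop : holdFrom f 0 = ⊤
  · refine Eventually.of_forall fun N => ?_
    have hc : ∀ u, f u = f 0 := fun u => by
      simpa using eq_of_lt_holdFrom (f := f) (t := 0) (u := u) (by simp [htop])
    refine iff_of_false ?_ (fun h => by simpa [htop] using h.2.2.1)
    rintro ⟨i, -, h0, h⟩
    rw [follows_replicate_append] at h
    have := h.2.1
    rw [hc, h0] at this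
    exact hkl this.symm
  obtain ⟨τ, hτ⟩ : ∃ τ : ℝ≥0, (τ : ℝ≥0∞) = holdFrom f 0 := ⟨_, ENNReal.coe_toNNReal htop⟩
  have hτpos : 0 < τ := by
    have := holdFrom_pos hf 0
    rw [← hτ] at this
    exact_mod_cast this
  have hrest : restart f = fun u => f (τ + u) := by
    funext u; simp [restart, ← hτ]
  set s : ℕ → ℝ≥0 := fun N => ⌈τ / mesh N⌉₊ * mesh N with hs
  have hsge : ∀ N, τ ≤ s N := fun N => by
    have := Nat.le_ceil (τ / mesh N)
    rwa [div_le_iff₀ (mesh_pos N)] at this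
  have hslt : ∀ N, s N < τ + mesh N := fun N => by
    have := Nat.ceil_lt_add_one (a := τ / mesh N) zero_le
    calc s N < (τ / mesh N + 1) * mesh N := mul_lt_mul_of_pos_right this (mesh_pos N)
      _ = τ + mesh N := by
        rw [add_mul, one_mul, div_mul_cancel₀ _ (mesh_pos N).ne']
  have hsT : Tendsto s atTop (𝓝[≥] τ) := by
    refine tendsto_nhdsWithin_iff.2 ⟨?_, Eventually.of_forall hsge⟩
    refine tendsto_of_tendsto_of_tendsto_of_le_of_le tendsto_const_nhds ?_ hsge
      (fun N => (hslt N).le)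
    simpa using tendsto_const_nhds.add tendsto_mesh
  have e3 : ∀ᶠ u in 𝓝[≥] τ, (t ≤ u ↔ t ≤ τ) := by
    by_cases h : t ≤ τ
    · filter_upwards [self_mem_nhdsWithin] with u hu
      exact iff_of_true (h.trans hu) h
    · filter_upwards [mem_nhdsWithin_of_mem_nhds (Iio_mem_nhds (not_le.1 h))] with u hu
      exact iff_of_false (not_le.2 hu) h
  filter_upwards [hsT.eventually (eventually_eq_right hf τ),
    hsT.eventually (eventually_follows_iff hf L τ), hsT.eventually e3] with N h1 h2 h3
  have hcpos : 0 < ⌈τ / mesh N⌉₊ := Nat.ceil_pos.2 (div_pos hτpos (mesh_pos N))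
  obtain ⟨i0, hi0⟩ : ∃ i0, ⌈τ / mesh N⌉₊ = i0 + 1 := ⟨_, (Nat.succ_pred hcpos.ne').symm⟩
  have hsN : s N = ((i0 : ℝ≥0) + 1) * mesh N := by simp [hs, hi0]
  have hbefore : ∀ j : ℕ, j ≤ i0 → f (j * mesh N) = f 0 := by
    intro j hj
    have : (j : ℝ≥0) * mesh N < τ := by
      rw [← lt_div_iff₀ (mesh_pos N), ← Nat.lt_ceil]
      omega
    simpa using eq_of_lt_holdFrom (f := f) (t := 0) (by rw [← hτ]; exact_mod_cast this)
  have hafter : f (s N) ≠ f 0 := by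
    rw [h1]
    simpa using ne_holdFrom hf hτ.symm
  -- Only `i0` can be an exit index: a smaller one is still in the initial state, a larger one would
  -- need that state at `s N`, where the path has already left it.
  have key : ∀ i : ℕ, (f 0 = k ∧ Follows f 0 (List.replicate i (mesh N, k) ++ (mesh N, l) :: L)) ↔
      i = i0 ∧ f 0 = k ∧ f τ = l ∧ Follows f τ L := by
    intro i
    rw [follows_replicate_append]
    simp only [Follows, zero_add]
    have hi : (i : ℝ≥0) * mesh N + mesh N = ((i : ℝ≥0) + 1) * mesh N := by ring
    rw [hi]
    constructor
    · rintro ⟨h0, hrep, hl, hL⟩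
      have hii : i = i0 := by
        rcases lt_trichotomy i i0 with h | h | h
        · have := hbefore (i + 1) (by omega)
          push_cast at this
          exact absurd (by rw [← hl, this, h0]) hkl
        · exact h
        · have := hrep i0 h
          rw [← hsN] at this
          exact absurd (by rw [this, h0]) hafter
      subst hii
      rw [← hsN] at hl hL
      exact ⟨rfl, h0, by rw [← h1, hl], h2.1 hL⟩
    · rintro ⟨rfl, h0, hl, hL⟩
      rw [← hsN]
      refine ⟨h0, fun j hj => ?_, by rw [h1, hl], h2.2 hL⟩
      have := hbefore (j + 1) (by omega)
      push_cast at this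
      rw [this, h0]
  have hFE : FirstExit k l t L f ↔ t ≤ τ ∧ f 0 = k ∧ f τ = l ∧ Follows f τ L := by
    unfold FirstExit
    rw [← hτ, hrest, follows_shift]
    simp only [add_zero, ENNReal.coe_le_coe, ENNReal.coe_lt_top, true_and]
    tauto
  rw [hFE, ← h3, hsN]
  constructor
  · rintro ⟨i, ht, h⟩
    obtain ⟨rfl, h⟩ := (key i).1 h
    exact ⟨ht, h⟩
  · rintro ⟨ht, h⟩
    exact ⟨i0, ht, (key i0).2 ⟨rfl, h⟩⟩

theorem firstExit_ne {f : ℝ≥0 → E} (hf : ∀ t, ContinuousWithinAt f (Set.Ici t) t) {k l : E}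
    {t : ℝ≥0} {L : List (ℝ≥0 × E)} (h : FirstExit k l t L f) : l ≠ k := by
  obtain ⟨h0, -, hfin, hl, -⟩ := h
  have := ne_holdFrom hf (ENNReal.coe_toNNReal hfin.ne).symm
  rw [← hl, ← h0]
  simpa [restart] using this

end Paths

/-! ### Finite-dimensional distributions from the Markov property -/

section Law

/-- Null-measurability is the right generality: events phrased with `jumpTime` will only be almost
everywhere equal to measurable ones. -/
theorem cond_real_eq_div {Ω : Type*} [MeasurableSpace Ω] {μ : Measure Ω} [IsFiniteMeasure μ]
    {A : Set Ω} (hA : NullMeasurableSet A μ) (B : Set Ω) :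
    (ProbabilityTheory.cond μ A).real B = μ.real (A ∩ B) / μ.real A := by
  unfold ProbabilityTheory.cond Measure.real
  rw [Measure.smul_apply, Measure.restrict_apply₀' hA, smul_eq_mul, ENNReal.toReal_mul,
    ENNReal.toReal_inv, Set.inter_comm, div_eq_inv_mul]

theorem measurableSet_follows {Ω E : Type*} [MeasurableSpace Ω] [MeasurableSpace E]
    [MeasurableSingletonClass E] {X : ℝ≥0 → Ω → E}
    (hX : ∀ t, Measurable (X t)) (L : List (ℝ≥0 × E)) (t : ℝ≥0) :
    MeasurableSet {ω | Follows (fun u => X u ω) t L} := by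
  induction L generalizing t with
  | nil => simp [Follows]
  | cons p L ih =>
    exact ((hX _) (measurableSet_singleton p.2)).inter (ih _)

variable {Ω E : Type*} [MeasurableSpace Ω] [Fintype E] [DecidableEq E]
  [MeasurableSpace E] [TopologicalSpace E]

/-- `X` has right-continuous paths and, up to its initial law, the finite-dimensional
distributions given by the transition function `P`. -/
structure HasMarkovLaw (μ : Measure Ω) (P : ℝ≥0 → Matrix E E ℝ) (X : ℝ≥0 → Ω → E) : Prop where
  measurable : ∀ t, Measurable (X t)
  right_continuous : ∀ ω t, ContinuousWithinAt (fun s => X s ω) (Set.Ici t) t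
  law : ∀ (k : E) (L : List (ℝ≥0 × E)), (∀ p ∈ L, 0 < p.1) →
    μ.real {ω | X 0 ω = k ∧ Follows (fun u => X u ω) 0 L} =
      μ.real {ω | X 0 ω = k} * pathWeight P k L

theorem IsMarkovChain.past_le [MeasurableSingletonClass E] {μ : Measure Ω}
    {P : ℝ≥0 → Matrix E E ℝ} {X : ℝ≥0 → Ω → E} (h : IsMarkovChain μ P X) (s : ℝ≥0) :
    past X s ≤ ‹MeasurableSpace Ω› :=
  iSup_le fun u => (h.measurable u).comap_le

/-- Induction on the itinerary: after each observation the present state joins the past event `A`.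
The past is strict, so this needs positive time increments. -/
theorem IsMarkovChain.follows [MeasurableSingletonClass E] {μ : Measure Ω} [IsProbabilityMeasure μ]
    {P : ℝ≥0 → Matrix E E ℝ} {X : ℝ≥0 → Ω → E} (h : IsMarkovChain μ P X)
    (L : List (ℝ≥0 × E)) (hL : ∀ p ∈ L, 0 < p.1) (s : ℝ≥0) (k : E) (A : Set Ω)
    (hA : MeasurableSet[past X s] A) :
    μ.real ({ω | X s ω = k} ∩ A ∩ {ω | Follows (fun u => X u ω) s L}) =
      μ.real ({ω | X s ω = k} ∩ A) * pathWeight P k L := by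
  induction L generalizing s k A with
  | nil => simp [Follows, pathWeight]
  | cons p L ih =>
    have hms : ∀ u e, MeasurableSet {ω | X u ω = e} :=
      fun u e => h.measurable u (measurableSet_singleton e)
    have hAm : MeasurableSet A := h.past_le s _ hA
    have hp : s < s + p.1 := lt_add_of_pos_right _ (hL p (by simp))
    have hA' : MeasurableSet[past X (s + p.1)] ({ω | X s ω = k} ∩ A) := by
      refine MeasurableSet.inter ?_ ?_
      · exact (le_iSup (fun u : Set.Iio (s + p.1) =>
          MeasurableSpace.comap (X u) inferInstance) ⟨s, hp⟩) _
          ⟨{k}, measurableSet_singleton k, rfl⟩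
      · refine (iSup_le fun u => ?_ : past X s ≤ past X (s + p.1)) _ hA
        exact le_iSup (fun u : Set.Iio (s + p.1) =>
          MeasurableSpace.comap (X u) inferInstance) ⟨u, (Set.mem_Iio.1 u.2).trans hp⟩
    have h1 := ih (fun q hq => hL q (by simp [hq])) (s + p.1) p.2 _ hA'
    have h2 : μ.real ({ω | X (s + p.1) ω = p.2} ∩ ({ω | X s ω = k} ∩ A)) =
        μ.real ({ω | X s ω = k} ∩ A) * P p.1 k p.2 := by
      by_cases h0 : μ ({ω | X s ω = k} ∩ A) = 0
      · rw [measureReal_def, measureReal_def, h0, measure_mono_null Set.inter_subset_right h0]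
        simp
      · have h0' : μ {ω | X s ω = k} ≠ 0 := fun h' =>
          h0 (measure_mono_null Set.inter_subset_left h')
        have := (h.markov s p.1 k p.2 A hA h0).trans (h.transition s p.1 k p.2 h0')
        rw [cond_real_eq_div ((hms s k).inter hAm).nullMeasurableSet] at this
        have hne : μ.real ({ω | X s ω = k} ∩ A) ≠ 0 :=
          ENNReal.toReal_ne_zero.2 ⟨h0, measure_ne_top _ _⟩
        rw [div_eq_iff hne] at this
        rw [Set.inter_comm, this, mul_comm]
    calc _ = μ.real ({ω | X (s + p.1) ω = p.2} ∩ ({ω | X s ω = k} ∩ A) ∩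
          {ω | Follows (fun u => X u ω) (s + p.1) L}) := by
          congr 1; ext ω; simp only [Follows, Set.mem_inter_iff, Set.mem_ofPred_eq]; tauto
      _ = _ := by rw [h1, h2, pathWeight]; ring

theorem IsMarkovChain.hasMarkovLaw [MeasurableSingletonClass E] {μ : Measure Ω}
    [IsProbabilityMeasure μ] {P : ℝ≥0 → Matrix E E ℝ} {X : ℝ≥0 → Ω → E}
    (h : IsMarkovChain μ P X) : HasMarkovLaw μ P X where
  measurable := h.measurable
  right_continuous := h.right_continuous
  law k L hL := by
    have := h.follows L hL 0 k Set.univ MeasurableSet.univ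
    simpa [Set.ofPred_and] using this

end Law

/-! ### Exit rates and jump probabilities as grid limits -/

section Rates

variable {E : Type*} {P : ℝ≥0 → Matrix E E ℝ}

theorem pathWeight_replicate_append (P : ℝ≥0 → Matrix E E ℝ) (h : ℝ≥0) (k : E)
    (L : List (ℝ≥0 × E)) (i : ℕ) :
    pathWeight P k (List.replicate i (h, k) ++ L) = P h k k ^ i * pathWeight P k L := by
  induction i with
  | zero => simp
  | succ i ih => rw [List.replicate_succ, List.cons_append, pathWeight, ih]; ring

/-- `derivWithin` is 0 where the derivative does not exist, so a positive rate certifies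
differentiability. -/
theorem hasDerivWithinAt_of_exitRate_pos {k : E} (hk : 0 < exitRate P k) :
    HasDerivWithinAt (fun t : ℝ => P t.toNNReal k k) (-exitRate P k) (Set.Ici 0) 0 := by
  have hd : DifferentiableWithinAt ℝ (fun t : ℝ => P t.toNNReal k k) (Set.Ici 0) 0 := by
    by_contra h
    simp [exitRate, derivWithin_zero_of_not_differentiableWithinAt h] at hk
  simpa [exitRate] using hd.hasDerivWithinAt

theorem tendsto_coe_mesh : Tendsto (fun N => (mesh N : ℝ)) atTop (𝓝[>] 0) := by
  refine tendsto_nhdsWithin_iff.2 ⟨?_, Eventually.of_forall fun N => ?_⟩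
  · exact NNReal.tendsto_coe.2 tendsto_mesh
  · exact_mod_cast mesh_pos N

variable [Fintype E] [DecidableEq E]

theorem IsTransitionFunction.le_one (hP : IsTransitionFunction P) (t : ℝ≥0) (k l : E) :
    P t k l ≤ 1 := by
  rw [← hP.row_sum t k]
  exact Finset.single_le_sum (f := fun l => P t k l) (fun l _ => hP.nonneg t k l)
    (Finset.mem_univ l)

theorem tendsto_log_div_mesh (hP : IsTransitionFunction P) {k : E} (hk : 0 < exitRate P k) :
    Tendsto (fun N => Real.log (P (mesh N) k k) / mesh N) atTop (𝓝 (-exitRate P k)) := by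
  have h1 := (hasDerivWithinAt_of_exitRate_pos hk).log (by simp [hP.zero])
  rw [hasDerivWithinAt_iff_tendsto_slope] at h1
  have h2 : Set.Ici (0 : ℝ) \ {0} = Set.Ioi 0 := Set.Ici_sdiff_left
  rw [h2] at h1
  have h3 := h1.comp tendsto_coe_mesh
  simp only [Real.toNNReal_zero, hP.zero, Matrix.one_apply_eq, div_one] at h3
  refine h3.congr fun N => ?_
  simp [slope_def_field, hP.zero]

theorem eventually_mesh_lt_one (hP : IsTransitionFunction P) {k : E} (hk : 0 < exitRate P k) :
    ∀ᶠ N in atTop, 0 < P (mesh N) k k ∧ P (mesh N) k k < 1 := by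
  have h1 : Tendsto (fun N => P (mesh N) k k) atTop (𝓝 1) := by
    have := (hP.continuousAt_zero k k).tendsto.comp tendsto_mesh
    simpa [hP.zero, Function.comp_def] using this
  filter_upwards [h1.eventually (lt_mem_nhds zero_lt_one),
    (tendsto_log_div_mesh hP hk).eventually (gt_mem_nhds (neg_lt_zero.2 hk))] with N h0 hlt
  refine ⟨h0, lt_of_le_of_ne (hP.le_one _ _ _) fun h => ?_⟩
  simp [h] at hlt

/-- Take logarithms: the exponent times the mesh lies between t - h and t, and log P_h(k,k)/h tends
to -λ_k. The `- 1` counts only the steps spent in `k`, not the one that leaves it. -/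
theorem tendsto_mesh_pow (hP : IsTransitionFunction P) {k : E} (hk : 0 < exitRate P k) (t : ℝ≥0) :
    Tendsto (fun N => P (mesh N) k k ^ (⌈t / mesh N⌉₊ - 1)) atTop
      (𝓝 (Real.exp (-exitRate P k * t))) := by
  have hm : Tendsto (fun N => ((⌈t / mesh N⌉₊ - 1 : ℕ) : ℝ) * mesh N) atTop (𝓝 t) := by
    have hmesh : Tendsto (fun N => (mesh N : ℝ)) atTop (𝓝 0) :=
      tendsto_coe_mesh.mono_right nhdsWithin_le_nhds
    refine tendsto_of_tendsto_of_tendsto_of_le_of_le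
      (by simpa using (tendsto_const_nhds (x := (t : ℝ))).sub hmesh) tendsto_const_nhds
      (fun N => ?_) fun N => ?_
    · have hpos : (0 : ℝ) < mesh N := mesh_pos N
      have h1 : (t : ℝ) / mesh N ≤ ⌈t / mesh N⌉₊ := by exact_mod_cast Nat.le_ceil (t / mesh N)
      have h2 : (⌈t / mesh N⌉₊ : ℝ) ≤ ((⌈t / mesh N⌉₊ - 1 : ℕ) : ℝ) + 1 := by
        exact_mod_cast le_tsub_add
      have h3 : (t : ℝ) ≤ (((⌈t / mesh N⌉₊ - 1 : ℕ) : ℝ) + 1) * mesh N :=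
        (div_le_iff₀ hpos).1 (h1.trans h2)
      simp only
      linarith
    · have h1 : (((⌈t / mesh N⌉₊ - 1 : ℕ) : ℝ≥0)) ≤ t / mesh N := by
        rcases Nat.eq_zero_or_pos ⌈t / mesh N⌉₊ with h | h
        · simp [h]
        · exact (Nat.lt_ceil.1 (Nat.sub_lt h one_pos)).le
      rw [le_div_iff₀ (mesh_pos N)] at h1
      exact_mod_cast h1
  have h := Real.continuous_exp.continuousAt.tendsto.comp
    ((tendsto_log_div_mesh hP hk).mul hm)
  refine h.congr' ?_
  filter_upwards [eventually_mesh_lt_one hP hk] with N hN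
  have hpos : (mesh N : ℝ) ≠ 0 := (NNReal.coe_pos.2 (mesh_pos N)).ne'
  rw [Function.comp_apply, show Real.log (P (mesh N) k k) / mesh N *
    (((⌈t / mesh N⌉₊ - 1 : ℕ) : ℝ) * mesh N) =
      ((⌈t / mesh N⌉₊ - 1 : ℕ) : ℝ) * Real.log (P (mesh N) k k) by field_simp,
    Real.exp_nat_mul, Real.exp_log hN.1]

/-- The probability that the chain of mesh `mesh N` moves to `l` when it leaves `k`. -/
def gridJump (P : ℝ≥0 → Matrix E E ℝ) (k l : E) (N : ℕ) : ℝ :=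
  P (mesh N) k l / (1 - P (mesh N) k k)

open Classical in
/-- The probability that the chain moves to `l` when it leaves `k`; an arbitrary stochastic
matrix for states whose jump probabilities are not known to exist. -/
def jumpProb (P : ℝ≥0 → Matrix E E ℝ) (k l : E) : ℝ :=
  if ∀ l', l' ≠ k → ∃ c, Tendsto (gridJump P k l') atTop (𝓝 c) then
    if l = k then 0 else limUnder atTop (gridJump P k l)
  else if l = k then 1 else 0

theorem jumpProb_self_of_tendsto {k : E}
    (h : ∀ l', l' ≠ k → ∃ c, Tendsto (gridJump P k l') atTop (𝓝 c)) : jumpProb P k k = 0 := by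
  rw [jumpProb, if_pos h, if_pos rfl]

theorem tendsto_gridJump {k : E}
    (h : ∀ l', l' ≠ k → ∃ c, Tendsto (gridJump P k l') atTop (𝓝 c)) {l : E} (hl : l ≠ k) :
    Tendsto (gridJump P k l) atTop (𝓝 (jumpProb P k l)) := by
  rw [jumpProb, if_pos h, if_neg hl]
  exact tendsto_nhds_limUnder (h l hl)

theorem jumpProb_nonneg (hP : IsTransitionFunction P) (k l : E) : 0 ≤ jumpProb P k l := by
  by_cases h : ∀ l', l' ≠ k → ∃ c, Tendsto (gridJump P k l') atTop (𝓝 c)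
  · by_cases hl : l = k
    · rw [hl, jumpProb_self_of_tendsto h]
    · exact ge_of_tendsto' (tendsto_gridJump h hl) fun N =>
        div_nonneg (hP.nonneg _ _ _) (sub_nonneg.2 (hP.le_one _ _ _))
  · rw [jumpProb, if_neg h]
    split_ifs <;> norm_num

theorem sum_jumpProb (hP : IsTransitionFunction P) {k : E} (hk : 0 < exitRate P k) :
    ∑ l, jumpProb P k l = 1 := by
  by_cases h : ∀ l', l' ≠ k → ∃ c, Tendsto (gridJump P k l') atTop (𝓝 c)
  · rw [← Finset.add_sum_erase _ _ (Finset.mem_univ k), jumpProb_self_of_tendsto h, zero_add]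
    refine tendsto_nhds_unique (tendsto_finsetSum _ fun l hl =>
      tendsto_gridJump h (Finset.ne_of_mem_erase hl)) (tendsto_const_nhds.congr' ?_)
    filter_upwards [eventually_mesh_lt_one hP hk] with N hN
    unfold gridJump
    rw [← Finset.sum_div, eq_div_iff (sub_pos.2 hN.2).ne', one_mul, sub_eq_iff_eq_add',
      Finset.add_sum_erase _ (fun l => P (mesh N) k l) (Finset.mem_univ k), hP.row_sum]
  · simp only [jumpProb, if_neg h]
    simp

end Rates

/-! ### The joint law of the first holding time, the next state and the later path -/

section FirstExit

variable {Ω E : Type*} [MeasurableSpace Ω]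
  [MeasurableSpace E] [MeasurableSingletonClass E] [TopologicalSpace E]
  {μ : Measure Ω} {P : ℝ≥0 → Matrix E E ℝ} {X : ℝ≥0 → Ω → E}

theorem HasMarkovLaw.measurableSet_gridExit (hX : HasMarkovLaw μ P X) (h : ℝ≥0) (k l : E)
    (t : ℝ≥0) (L : List (ℝ≥0 × E)) (i : ℕ) :
    MeasurableSet {ω | GridExit h k l t L (fun u => X u ω) i} :=
  (MeasurableSet.const _).inter ((hX.measurable 0 (measurableSet_singleton k)).inter
    (measurableSet_follows hX.measurable _ _))

theorem HasMarkovLaw.measurableSet_exists_gridExit (hX : HasMarkovLaw μ P X) (h : ℝ≥0) (k l : E)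
    (t : ℝ≥0) (L : List (ℝ≥0 × E)) :
    MeasurableSet {ω | ∃ i, GridExit h k l t L (fun u => X u ω) i} := by
  rw [Set.ofPred_exists]
  exact MeasurableSet.iUnion fun i => hX.measurableSet_gridExit h k l t L i

/-- The exit index is unique since `l ≠ k`, so the masses of the cylinders with `i` stays add up to
a geometric series in `P h k k`, started at the least `i` with (i+1)h ≥ t. -/
theorem HasMarkovLaw.real_exists_gridExit [IsFiniteMeasure μ] (hX : HasMarkovLaw μ P X)
    {h : ℝ≥0} (hh : 0 < h) {k l : E} (hkl : l ≠ k) (hp0 : 0 ≤ P h k k) (hp1 : P h k k < 1)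
    (t : ℝ≥0) {L : List (ℝ≥0 × E)} (hL : ∀ p ∈ L, 0 < p.1) :
    μ.real {ω | ∃ i, GridExit h k l t L (fun u => X u ω) i} =
      μ.real {ω | X 0 ω = k} * (P h k k ^ (⌈t / h⌉₊ - 1) * (P h k l / (1 - P h k k)) *
        pathWeight P l L) := by
  set m := ⌈t / h⌉₊ - 1 with hm
  have hiff : ∀ i : ℕ, t ≤ (i + 1) * h ↔ m ≤ i := by
    intro i
    rw [← div_le_iff₀ hh, hm, tsub_le_iff_right, Nat.ceil_le]
    push_cast
    rfl
  have hU : {ω | ∃ i, GridExit h k l t L (fun u => X u ω) i} =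
      ⋃ i, {ω | GridExit h k l t L (fun u => X u ω) (m + i)} := by
    ext ω
    simp only [Set.mem_ofPred_eq, Set.mem_iUnion]
    constructor
    · rintro ⟨i, hi⟩
      refine ⟨i - m, ?_⟩
      rwa [Nat.add_sub_cancel' ((hiff i).1 hi.1)]
    · rintro ⟨i, hi⟩
      exact ⟨_, hi⟩
  have hval : ∀ i, μ.real {ω | GridExit h k l t L (fun u => X u ω) (m + i)} =
      μ.real {ω | X 0 ω = k} * (P h k k ^ m * P h k l * pathWeight P l L) * P h k k ^ i := by
    intro i
    have hpos : ∀ p ∈ List.replicate (m + i) (h, k) ++ (h, l) :: L, 0 < p.1 := by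
      intro p hp
      rcases List.mem_append.1 hp with hp | hp
      · rw [(List.mem_replicate.1 hp).2]; exact hh
      · rcases List.mem_cons.1 hp with rfl | hp
        · exact hh
        · exact hL p hp
    have hset : {ω | GridExit h k l t L (fun u => X u ω) (m + i)} =
        {ω | X 0 ω = k ∧ Follows (fun u => X u ω) 0
          (List.replicate (m + i) (h, k) ++ (h, l) :: L)} := by
      ext ω
      simp only [GridExit, Set.mem_ofPred_eq, and_iff_right_iff_imp]
      intro _
      exact (hiff _).2 (Nat.le_add_right _ _)
    rw [hset, hX.law k _ hpos, pathWeight_replicate_append, pathWeight, pow_add]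
    ring
  have hdisj : ∀ i j, i < j → Disjoint {ω | GridExit h k l t L (fun u => X u ω) (m + i)}
      {ω | GridExit h k l t L (fun u => X u ω) (m + j)} := by
    intro i j hij
    rw [Set.disjoint_left]
    rintro ω ⟨-, -, h1⟩ ⟨-, -, h2⟩
    rw [follows_replicate_append] at h1 h2
    have e1 := h1.2.1
    have e2 := h2.1 (m + i) (by omega)
    simp only [zero_add] at e1 e2
    rw [show ((m + i : ℕ) : ℝ≥0) * h + h = (((m + i : ℕ) : ℝ≥0) + 1) * h by ring, e2] at e1
    exact hkl e1.symm
  rw [hU, measureReal_def, measure_iUnion ?_ (fun i => hX.measurableSet_gridExit _ _ _ _ _ _),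
    ENNReal.tsum_toReal_eq fun i => measure_ne_top _ _]
  · change ∑' i, μ.real _ = _
    simp only [hval]
    rw [tsum_mul_left, tsum_geometric_of_lt_one hp0 hp1]
    ring
  · intro i j hij
    rcases lt_or_gt_of_ne hij with h' | h'
    · exact hdisj i j h'
    · exact (hdisj j i h').symm

variable [DiscreteTopology E]

/-- A pointwise limit of grid events, each of which involves only countably many coordinates. -/
theorem HasMarkovLaw.measurableSet_firstExit (hX : HasMarkovLaw μ P X) (k l : E) (t : ℝ≥0)
    (L : List (ℝ≥0 × E)) : MeasurableSet {ω | FirstExit k l t L (fun u => X u ω)} := by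
  by_cases hkl : l = k
  · convert MeasurableSet.empty
    exact Set.eq_empty_of_forall_notMem fun ω h => firstExit_ne (hX.right_continuous ω) h hkl
  · exact measurableSet_of_tendsto_indicator atTop
      (fun N => hX.measurableSet_exists_gridExit (mesh N) k l t L)
      (fun ω => eventually_gridExit_iff (hX.right_continuous ω) hkl t L)

variable [Fintype E] [DecidableEq E]

/-- The limit of the grid formula. Off-diagonal derivatives of `P` are never needed: their ratio to
the diagonal one converges because the measures of the grid events do. -/
theorem HasMarkovLaw.real_firstExit [IsFiniteMeasure μ] (hX : HasMarkovLaw μ P X)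
    (hP : IsTransitionFunction P) {k : E} (hk : 0 < exitRate P k) (l : E) (t : ℝ≥0)
    {L : List (ℝ≥0 × E)} (hL : ∀ p ∈ L, 0 < p.1) :
    μ.real {ω | FirstExit k l t L (fun u => X u ω)} =
      μ.real {ω | X 0 ω = k} * (Real.exp (-exitRate P k * t) * jumpProb P k l *
        pathWeight P l L) := by
  -- If `k` is not charged initially, both sides vanish and it does not matter whether the jump
  -- limits exist.
  by_cases ha : μ.real {ω | X 0 ω = k} = 0
  · rw [ha, zero_mul]
    exact measureReal_mono_null (fun ω h => h.1) ha
  have hconv : ∀ (l : E), l ≠ k → ∀ (t : ℝ≥0) (L : List (ℝ≥0 × E)), (∀ p ∈ L, 0 < p.1) →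
      Tendsto (fun N => μ.real {ω | X 0 ω = k} * (P (mesh N) k k ^ (⌈t / mesh N⌉₊ - 1) *
        gridJump P k l N * pathWeight P l L)) atTop
        (𝓝 (μ.real {ω | FirstExit k l t L (fun u => X u ω)})) := by
    intro l hkl t L hL
    have := tendsto_measure_of_tendsto_indicator_of_isFiniteMeasure atTop μ
      (fun N => hX.measurableSet_exists_gridExit (mesh N) k l t L)
      (fun ω => eventually_gridExit_iff (hX.right_continuous ω) hkl t L)
    refine ((ENNReal.tendsto_toReal (measure_ne_top _ _)).comp this).congr' ?_
    filter_upwards [eventually_mesh_lt_one hP hk] with N hN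
    exact hX.real_exists_gridExit (mesh_pos N) hkl hN.1.le hN.2 t hL
  have hlim : ∀ l', l' ≠ k → ∃ c, Tendsto (gridJump P k l') atTop (𝓝 c) := by
    intro l' hl'
    -- At time 0 and with no further observations, the power and the path weight are both 1, leaving
    -- `gridJump` alone.
    have := (hconv l' hl' 0 [] (by simp)).const_mul (μ.real {ω | X 0 ω = k})⁻¹
    refine ⟨_, this.congr fun N => ?_⟩
    simp [pathWeight, ha]
  by_cases hkl : l = k
  · rw [hkl, jumpProb_self_of_tendsto hlim]
    have : {ω | FirstExit k k t L (fun u => X u ω)} = ∅ :=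
      Set.eq_empty_of_forall_notMem fun ω h => firstExit_ne (hX.right_continuous ω) h rfl
    simp [this]
  · exact tendsto_nhds_unique (hconv l hkl t L hL)
      ((((tendsto_mesh_pow hP hk t).mul (tendsto_gridJump hlim hkl)).mul_const _).const_mul _)

end FirstExit

/-! ### Regeneration at the first jump -/

section Restart

theorem sum_real_inter_fiber {Ω E : Type*} [MeasurableSpace Ω] [Fintype E] [MeasurableSpace E]
    [MeasurableSingletonClass E] {μ : Measure Ω} [IsFiniteMeasure μ] {f : Ω → E}
    (hf : Measurable f) (A : Set Ω) : ∑ e, μ.real (A ∩ {ω | f ω = e}) = μ.real A := by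
  have hm : ∀ e, MeasurableSet (f ⁻¹' {e}) := fun e => hf (measurableSet_singleton e)
  have := sum_measureReal_preimage_singleton (μ := μ.restrict A) Finset.univ (f := f)
    (fun e _ => hm e)
  simp only [measureReal_restrict_apply (hm _)] at this
  simp only [Finset.coe_univ, Set.preimage_univ, measureReal_restrict_apply MeasurableSet.univ,
    Set.univ_inter] at this
  rw [← this]
  exact Finset.sum_congr rfl fun e _ => by rw [Set.inter_comm]; rfl

/-- The process seen from its first jump on. -/
def restarted {Ω E : Type*} (X : ℝ≥0 → Ω → E) : ℝ≥0 → Ω → E :=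
  fun u ω => restart (fun v => X v ω) u

/-- The holding time of the initial state. -/
def firstHold {Ω E : Type*} (X : ℝ≥0 → Ω → E) (ω : Ω) : ℝ≥0∞ := holdFrom (fun u => X u ω) 0

variable {Ω E : Type*} [MeasurableSpace Ω] [MeasurableSpace E] [MeasurableSingletonClass E]
  [TopologicalSpace E] [DiscreteTopology E] [Fintype E]
  {μ : Measure Ω} {P : ℝ≥0 → Matrix E E ℝ} {X : ℝ≥0 → Ω → E}

/-- Upper level sets of the finite part are finite unions of first-exit events; the value `⊤` is the
complement of one of them. -/
theorem HasMarkovLaw.measurable_firstHold (hX : HasMarkovLaw μ P X) :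
    Measurable (firstHold X) := by
  have hfin : ∀ t : ℝ≥0, MeasurableSet {ω | (t : ℝ≥0∞) ≤ firstHold X ω ∧ firstHold X ω < ⊤} := by
    intro t
    have : {ω | (t : ℝ≥0∞) ≤ firstHold X ω ∧ firstHold X ω < ⊤} =
        ⋃ k, ⋃ l, {ω | FirstExit k l t [] (fun u => X u ω)} := by
      ext ω
      simp [FirstExit, firstHold, Follows]
    rw [this]
    exact MeasurableSet.iUnion fun k => MeasurableSet.iUnion fun l =>
      hX.measurableSet_firstExit k l t []
  have htop : MeasurableSet {ω | firstHold X ω = ⊤} := by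
    have : {ω | firstHold X ω = ⊤} =
        {ω | ((0 : ℝ≥0) : ℝ≥0∞) ≤ firstHold X ω ∧ firstHold X ω < ⊤}ᶜ := by
      ext ω; simp
    rw [this]
    exact (hfin 0).compl
  refine measurable_of_Ici fun c => ?_
  by_cases hc : c = ⊤
  · simpa [hc, Set.preimage] using htop
  · lift c to ℝ≥0 using hc
    convert (hfin c).union htop
    ext ω
    by_cases h : firstHold X ω = ⊤ <;> simp [h, lt_top_iff_ne_top]

theorem HasMarkovLaw.measurable_restarted (hX : HasMarkovLaw μ P X) (u : ℝ≥0) :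
    Measurable (restarted X u) := by
  refine measurable_to_countable' fun e => ?_
  have : restarted X u ⁻¹' {e} =
      (⋃ k, ⋃ l, {ω | FirstExit k l 0 [(u, e)] (fun u => X u ω)}) ∪
        ({ω | firstHold X ω = ⊤} ∩ {ω | X u ω = e}) := by
    ext ω
    -- An infinite holding time becomes 0 under `toNNReal`, so there the restarted path is the path
    -- itself.
    by_cases h : firstHold X ω = ⊤
    · have h' : holdFrom (fun u => X u ω) 0 = ⊤ := h
      simp [FirstExit, h, h', restarted, restart]
    · have h' : holdFrom (fun u => X u ω) 0 ≠ ⊤ := h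
      simp [FirstExit, h, h', restarted, Follows, lt_top_iff_ne_top]
  rw [this]
  exact (MeasurableSet.iUnion fun k => MeasurableSet.iUnion fun l =>
    hX.measurableSet_firstExit k l 0 _).union
    ((hX.measurable_firstHold (measurableSet_singleton _)).inter
      (hX.measurable u (measurableSet_singleton e)))

/-- The event that the initial state is `k` and is kept for a time in `[s, t)`. -/
def sliceSet (X : ℝ≥0 → Ω → E) (k : E) (s t : ℝ≥0) : Set Ω :=
  {ω | X 0 ω = k ∧ s ≤ firstHold X ω ∧ firstHold X ω < t}

theorem HasMarkovLaw.measurableSet_sliceSet (hX : HasMarkovLaw μ P X) (k : E) (s t : ℝ≥0) :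
    MeasurableSet (sliceSet X k s t) :=
  (hX.measurable 0 (measurableSet_singleton k)).inter
    ((measurableSet_le measurable_const hX.measurable_firstHold).inter
      (measurableSet_lt hX.measurable_firstHold measurable_const))

variable [DecidableEq E] [IsFiniteMeasure μ]

/-- The masses of finite exits from `k` into the various `l` already add up to the mass of `k`,
since the jump probabilities sum to 1. -/
theorem HasMarkovLaw.ae_firstHold_lt_top (hX : HasMarkovLaw μ P X)
    (hP : IsTransitionFunction P) (hr : ∀ k, 0 < exitRate P k) :
    ∀ᵐ ω ∂μ, firstHold X ω < ⊤ := by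
  have h : ∀ k, ∀ᵐ ω ∂μ, X 0 ω = k → firstHold X ω < ⊤ := by
    intro k
    have hA : μ.real {ω | X 0 ω = k ∧ firstHold X ω < ⊤} = μ.real {ω | X 0 ω = k} := by
      rw [← sum_real_inter_fiber (hX.measurable_restarted 0)]
      have : ∀ l, μ.real ({ω | X 0 ω = k ∧ firstHold X ω < ⊤} ∩
          {ω | restarted X 0 ω = l}) = μ.real {ω | X 0 ω = k} * jumpProb P k l := by
        intro l
        have := hX.real_firstExit hP (hr k) l 0 (L := []) (by simp)
        simp only [NNReal.coe_zero, mul_zero, Real.exp_zero, one_mul, pathWeight, mul_one] at this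
        rw [← this]
        congr 1
        ext ω
        simp [FirstExit, firstHold, Follows, restarted, and_assoc]
      simp only [this, ← Finset.mul_sum, sum_jumpProb hP (hr k), mul_one]
    have hm : MeasurableSet {ω | X 0 ω = k ∧ firstHold X ω < ⊤} :=
      (hX.measurable 0 (measurableSet_singleton k)).inter
        (measurableSet_lt hX.measurable_firstHold measurable_const)
    have hsub : {ω | X 0 ω = k ∧ firstHold X ω < ⊤} ⊆ {ω | X 0 ω = k} := fun ω h => h.1
    have := measureReal_sdiff (μ := μ) hsub hm
    rw [hA, sub_self, measureReal_eq_zero_iff] at this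
    rw [ae_iff]
    convert this using 2
    ext ω
    simp +contextual
  filter_upwards [ae_all_iff.2 h] with ω hω
  exact hω _ rfl

theorem HasMarkovLaw.real_exit (hX : HasMarkovLaw μ P X)
    (hP : IsTransitionFunction P) (hr : ∀ k, 0 < exitRate P k) (k l : E) (t : ℝ≥0)
    {L : List (ℝ≥0 × E)} (hL : ∀ p ∈ L, 0 < p.1) :
    μ.real {ω | X 0 ω = k ∧ t ≤ firstHold X ω ∧ restarted X 0 ω = l ∧
      Follows (fun u => restarted X u ω) 0 L} =
      μ.real {ω | X 0 ω = k} * (Real.exp (-exitRate P k * t) * jumpProb P k l *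
        pathWeight P l L) := by
  rw [← hX.real_firstExit hP (hr k) l t hL]
  refine measureReal_congr ?_
  filter_upwards [hX.ae_firstHold_lt_top hP hr] with ω hω
  refine propext ?_
  have hω' : holdFrom (fun u => X u ω) 0 < ⊤ := hω
  change ω ∈ {ω | _} ↔ ω ∈ {ω | _}
  simp only [Set.mem_ofPred_eq, hω', firstHold, true_and]
  rfl

theorem HasMarkovLaw.real_le_firstHold (hX : HasMarkovLaw μ P X)
    (hP : IsTransitionFunction P) (hr : ∀ k, 0 < exitRate P k) (k : E) (t : ℝ≥0) :
    μ.real {ω | X 0 ω = k ∧ t ≤ firstHold X ω} =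
      μ.real {ω | X 0 ω = k} * Real.exp (-exitRate P k * t) := by
  rw [← sum_real_inter_fiber (hX.measurable_restarted 0)]
  have : ∀ l, μ.real ({ω | X 0 ω = k ∧ t ≤ firstHold X ω} ∩ {ω | restarted X 0 ω = l}) =
      μ.real {ω | X 0 ω = k} * Real.exp (-exitRate P k * t) * jumpProb P k l := by
    intro l
    have := hX.real_exit hP hr k l t (L := []) (by simp)
    rw [pathWeight, mul_one, ← mul_assoc] at this
    rw [← this]
    congr 1
    ext ω
    simp [Follows, and_assoc]
  simp only [this, ← Finset.mul_sum, sum_jumpProb hP (hr k), mul_one]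

/-- The strong Markov property at the first jump, obtained by summing the exit law at t = 0 over the
initial states; only the initial law changes. -/
theorem HasMarkovLaw.after_jump (hX : HasMarkovLaw μ P X)
    (hP : IsTransitionFunction P) (hr : ∀ k, 0 < exitRate P k) :
    HasMarkovLaw μ P (restarted X) where
  measurable := hX.measurable_restarted
  right_continuous ω := restart_rightContinuous (hX.right_continuous ω)
  law l L hL := by
    have h : ∀ L : List (ℝ≥0 × E), (∀ p ∈ L, 0 < p.1) →
        μ.real {ω | restarted X 0 ω = l ∧
          Follows (fun u => restarted X u ω) 0 L} =
        (∑ k, μ.real {ω | X 0 ω = k} * jumpProb P k l) * pathWeight P l L := by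
      intro L hL
      rw [← sum_real_inter_fiber (hX.measurable 0), Finset.sum_mul]
      refine Finset.sum_congr rfl fun k _ => ?_
      have := hX.real_exit hP hr k l 0 hL
      simp only [NNReal.coe_zero, mul_zero, Real.exp_zero, one_mul] at this
      rw [mul_assoc, ← this]
      congr 1
      ext ω
      simp only [Set.mem_inter_iff, Set.mem_ofPred_eq, ENNReal.coe_zero, zero_le, true_and]
      tauto
    have h0 := h [] (by simp)
    simp only [Follows, and_true, pathWeight, mul_one] at h0
    rw [h L hL, h0]

theorem HasMarkovLaw.real_sliceSet (hX : HasMarkovLaw μ P X)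
    (hP : IsTransitionFunction P) (hr : ∀ k, 0 < exitRate P k) (k : E) {s t : ℝ≥0} (hst : s ≤ t) :
    μ.real (sliceSet X k s t) = μ.real {ω | X 0 ω = k} *
      (Real.exp (-exitRate P k * s) - Real.exp (-exitRate P k * t)) := by
  have hset : sliceSet X k s t = {ω | X 0 ω = k ∧ s ≤ firstHold X ω} \
      {ω | X 0 ω = k ∧ t ≤ firstHold X ω} := by
    ext ω
    simp only [sliceSet, Set.mem_ofPred_eq, Set.mem_sdiff, not_and, not_le]
    tauto
  rw [hset, measureReal_sdiff, hX.real_le_firstHold hP hr, hX.real_le_firstHold hP hr, mul_sub]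
  · exact fun ω h => ⟨h.1, le_trans (by exact_mod_cast hst) h.2⟩
  · exact (hX.measurable 0 (measurableSet_singleton k)).inter
      (measurableSet_le measurable_const hX.measurable_firstHold)

/-- A slice is a difference of two tail events, and in the exit law the tail time enters only
through the exponential. Hence the length of the stay is independent of what follows it. -/
theorem HasMarkovLaw.real_sliceSet_inter (hX : HasMarkovLaw μ P X)
    (hP : IsTransitionFunction P) (hr : ∀ k, 0 < exitRate P k) (k l : E) {s t : ℝ≥0} (hst : s ≤ t)
    {L : List (ℝ≥0 × E)} (hL : ∀ p ∈ L, 0 < p.1) :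
    μ.real ({ω | restarted X 0 ω = l ∧
        Follows (fun u => restarted X u ω) 0 L} ∩ sliceSet X k s t) =
      μ.real (sliceSet X k s t) * jumpProb P k l * pathWeight P l L := by
  have hm := (hX.after_jump hP hr).measurable
  have hset : {ω | restarted X 0 ω = l ∧
        Follows (fun u => restarted X u ω) 0 L} ∩ sliceSet X k s t =
      {ω | X 0 ω = k ∧ s ≤ firstHold X ω ∧ restarted X 0 ω = l ∧
        Follows (fun u => restarted X u ω) 0 L} \
      {ω | X 0 ω = k ∧ t ≤ firstHold X ω ∧ restarted X 0 ω = l ∧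
        Follows (fun u => restarted X u ω) 0 L} := by
    ext ω
    simp only [sliceSet, Set.mem_ofPred_eq, Set.mem_sdiff, Set.mem_inter_iff, not_and, ← not_le]
    tauto
  rw [hset, measureReal_sdiff, hX.real_exit hP hr k l s hL, hX.real_exit hP hr k l t hL,
    hX.real_sliceSet hP hr k hst]
  · ring
  · exact fun ω h => ⟨h.1, le_trans (by exact_mod_cast hst) h.2.1, h.2.2⟩
  · exact (hX.measurable 0 (measurableSet_singleton k)).inter
      ((measurableSet_le measurable_const hX.measurable_firstHold).inter
        ((hm 0 (measurableSet_singleton l)).inter (measurableSet_follows hm L 0)))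

/-- Restriction in place of conditioning avoids any case distinction for null slices; this is why
`HasMarkovLaw` leaves the total mass and the initial law free. -/
theorem HasMarkovLaw.restrict_sliceSet (hX : HasMarkovLaw μ P X)
    (hP : IsTransitionFunction P) (hr : ∀ k, 0 < exitRate P k) (k : E) {s t : ℝ≥0} (hst : s ≤ t) :
    HasMarkovLaw (μ.restrict (sliceSet X k s t)) P (restarted X) where
  measurable := hX.measurable_restarted
  right_continuous ω := restart_rightContinuous (hX.right_continuous ω)
  law l L hL := by
    have hm := (hX.after_jump hP hr).measurable
    have h0 := hX.real_sliceSet_inter hP hr k l hst (L := []) (by simp)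
    simp only [Follows, and_true, pathWeight, mul_one] at h0
    have hml : MeasurableSet {ω | restarted X 0 ω = l} := hm 0 (measurableSet_singleton l)
    have hmL : MeasurableSet {ω | restarted X 0 ω = l ∧
        Follows (fun u => restarted X u ω) 0 L} := hml.inter (measurableSet_follows hm L 0)
    rw [measureReal_restrict_apply hml, measureReal_restrict_apply hmL,
      hX.real_sliceSet_inter hP hr k l hst hL]
    exact congrArg (· * _) h0.symm

end Restart

/-! ### Pieces of a path as iterated restarts -/

section Pieces

theorem holdFrom_shift {E : Type*} (f : ℝ≥0 → E) (a : ℝ≥0) :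
    holdFrom (fun u => f (a + u)) 0 = holdFrom f a := by
  simp [holdFrom]

theorem restart_iterate_eq {E : Type*} (f : ℝ≥0 → E) (j : ℕ)
    (h : ∀ i < j, holdFrom (restart^[i] f) 0 < ⊤) :
    jumpTime f j < ⊤ ∧ restart^[j] f = fun u => f ((jumpTime f j).toNNReal + u) := by
  induction j with
  | zero => simp [jumpTime]
  | succ j ih =>
    obtain ⟨h1, h2⟩ := ih fun i hi => h i (hi.trans j.lt_succ_self)
    have h3 := h j j.lt_succ_self
    rw [h2, holdFrom_shift] at h3
    refine ⟨ENNReal.add_lt_top.2 ⟨h1, h3⟩, ?_⟩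
    rw [Function.iterate_succ_apply', h2]
    funext u
    simp only [restart, holdFrom_shift]
    rw [jumpTime, ENNReal.toNNReal_add h1.ne h3.ne, add_assoc]

theorem restarted_iterate {Ω E : Type*} (X : ℝ≥0 → Ω → E) (j : ℕ) (ω : Ω) :
    (fun u => restarted^[j] X u ω) = restart^[j] (fun u => X u ω) := by
  induction j with
  | zero => rfl
  | succ j ih =>
    rw [Function.iterate_succ_apply', Function.iterate_succ_apply', ← ih]
    rfl

/-- Finiteness of the holding times is essential: only then does `toNNReal` keep the jump times and
turn their sums into successive shifts. -/
theorem pieces_eq {Ω E : Type*} {X : ℝ≥0 → Ω → E} {ω : Ω}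
    (h : ∀ i, firstHold (restarted^[i] X) ω < ⊤) (j : ℕ) :
    pieceState (fun u => X u ω) j = restarted^[j] X 0 ω ∧
      holdingTime (fun u => X u ω) j = firstHold (restarted^[j] X) ω := by
  have h' : ∀ i, holdFrom (restart^[i] fun u => X u ω) 0 < ⊤ := fun i => by
    rw [← restarted_iterate]; exact h i
  have h2 := (restart_iterate_eq (fun u => X u ω) j fun i _ => h' i).2
  constructor
  · have := congrFun ((restarted_iterate X j ω).trans h2) 0
    simpa [pieceState] using this.symm
  · rw [firstHold, restarted_iterate, h2, holdFrom_shift (fun u => X u ω)]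
    rfl

/-- The history event in terms of the restarted processes. -/
def restartHistory {Ω E : Type*} (X : ℝ≥0 → Ω → E) {n : ℕ} (k : Fin n → E)
    (t : Fin n → ℕ) (j : ℕ) : Set Ω :=
  {ω | ∀ i : Fin n, (i : ℕ) < j →
    ω ∈ sliceSet (restarted^[i] X) (k i) (t i : ℝ≥0) ((t i + 1 : ℕ) : ℝ≥0)}

theorem restartHistory_succ {Ω E : Type*} (X : ℝ≥0 → Ω → E) {n : ℕ} (k : Fin n → E) (t : Fin n → ℕ)
    (j : Fin n) : restartHistory X k t (j + 1) =
      sliceSet (restarted^[j] X) (k j) (t j : ℝ≥0) ((t j + 1 : ℕ) : ℝ≥0) ∩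
        restartHistory X k t j := by
  ext ω
  simp only [restartHistory, Set.mem_ofPred_eq, Set.mem_inter_iff]
  constructor
  · exact fun h => ⟨h j (Nat.lt_succ_self _), fun i hi => h i (hi.trans (Nat.lt_succ_self _))⟩
  · rintro ⟨h1, h2⟩ i hi
    rcases Nat.lt_succ_iff_lt_or_eq.1 hi with h | h
    · exact h2 i h
    · rwa [Fin.ext h]

end Pieces

/-! ### Laws of the pieces and factorization of the amplitude -/

section Amplitude

variable {Ω E : Type*} [MeasurableSpace Ω] [MeasurableSpace E] [MeasurableSingletonClass E]
  [TopologicalSpace E] [DiscreteTopology E] [Fintype E] [DecidableEq E]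
  {μ : Measure Ω} {P : ℝ≥0 → Matrix E E ℝ} {X : ℝ≥0 → Ω → E}

theorem HasMarkovLaw.iterate [IsFiniteMeasure μ] (hX : HasMarkovLaw μ P X)
    (hP : IsTransitionFunction P) (hr : ∀ k, 0 < exitRate P k) (j : ℕ) :
    HasMarkovLaw μ P (restarted^[j] X) := by
  induction j with
  | zero => exact hX
  | succ j ih =>
    rw [Function.iterate_succ_apply']
    exact ih.after_jump hP hr

theorem HasMarkovLaw.ae_pieces_eq [IsFiniteMeasure μ] (hX : HasMarkovLaw μ P X)
    (hP : IsTransitionFunction P) (hr : ∀ k, 0 < exitRate P k) :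
    ∀ᵐ ω ∂μ, ∀ j, pieceState (fun u => X u ω) j = restarted^[j] X 0 ω ∧
      holdingTime (fun u => X u ω) j = firstHold (restarted^[j] X) ω := by
  filter_upwards [ae_all_iff.2 fun j => (hX.iterate hP hr j).ae_firstHold_lt_top hP hr] with ω hω
  exact pieces_eq hω

variable [IsFiniteMeasure μ]

theorem HasMarkovLaw.measurableSet_restartHistory (hX : HasMarkovLaw μ P X)
    (hP : IsTransitionFunction P) (hr : ∀ k, 0 < exitRate P k) {n : ℕ} (k : Fin n → E)
    (t : Fin n → ℕ) (j : ℕ) : MeasurableSet (restartHistory X k t j) := by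
  simp only [restartHistory, Set.ofPred_forall]
  exact MeasurableSet.iInter fun i => MeasurableSet.iInter fun _ =>
    (hX.iterate hP hr i).measurableSet_sliceSet _ _ _

/-- Each earlier piece contributes one restriction to a slice followed by one restart, and both
preserve the Markov law. -/
theorem HasMarkovLaw.restrict_restartHistory (hX : HasMarkovLaw μ P X)
    (hP : IsTransitionFunction P) (hr : ∀ k, 0 < exitRate P k) {n : ℕ} (k : Fin n → E)
    (t : Fin n → ℕ) {j : ℕ} (hj : j ≤ n) :
    HasMarkovLaw (μ.restrict (restartHistory X k t j)) P (restarted^[j] X) := by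
  induction j with
  | zero => simpa [restartHistory] using hX
  | succ j ih =>
    have hs := restartHistory_succ X k t ⟨j, hj⟩
    simp only at hs
    rw [hs, ← Measure.restrict_restrict ((hX.iterate hP hr j).measurableSet_sliceSet _ _ _),
      Function.iterate_succ_apply']
    exact (ih (Nat.le_of_succ_le hj)).restrict_sliceSet hP hr _ (by gcongr; exact Nat.le_succ _)

/-- The state of the piece before the `j`-th one, if there is one. -/
def previous {Z : Type*} {n : ℕ} (z : Fin n → Z) (j : Fin n) : Option Z :=
  if h : (j : ℕ) = 0 then none else some (z ⟨j - 1, by omega⟩)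

/-- The law of the state of a piece given the state of the previous piece. -/
def entryProb (μ : Measure Ω) (P : ℝ≥0 → Matrix E E ℝ) (X : ℝ≥0 → Ω → E) : Option E → E → ℝ
  | none, l => μ.real {ω | X 0 ω = l}
  | some k, l => jumpProb P k l

/-- The mass of the `t`-th time slice for an exponential law of rate `r` truncated to
`[0, T)`. -/
def sliceProb (r : ℝ) (T t : ℕ) : ℝ :=
  (Real.exp (-r * t) - Real.exp (-r * (t + 1 : ℕ))) / (1 - Real.exp (-r * T))

/-- Of the whole history only the previous state matters: the slice law is applied under the measure
restricted to the history before the previous piece. -/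
theorem HasMarkovLaw.real_restartHistory_inter_state {μ : Measure Ω} [IsProbabilityMeasure μ]
    (hX : HasMarkovLaw μ P X)
    (hP : IsTransitionFunction P) (hr : ∀ k, 0 < exitRate P k) {n : ℕ} (k : Fin n → E)
    (t : Fin n → ℕ) (j : Fin n) (l : E) :
    μ.real (restartHistory X k t j ∩ {ω | restarted^[j] X 0 ω = l}) =
      μ.real (restartHistory X k t j) * entryProb μ P X (previous k j) l := by
  obtain ⟨j, hj⟩ := j
  cases j with
  | zero => simp [restartHistory, previous, entryProb]
  | succ j =>
    have hs := restartHistory_succ X k t ⟨j, Nat.lt_of_succ_lt hj⟩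
    simp only at hs
    have hms := (hX.iterate hP hr j).measurableSet_sliceSet (k ⟨j, Nat.lt_of_succ_lt hj⟩)
      (t ⟨j, Nat.lt_of_succ_lt hj⟩ : ℝ≥0) ((t ⟨j, Nat.lt_of_succ_lt hj⟩ + 1 : ℕ) : ℝ≥0)
    have hml : MeasurableSet {ω | restarted (restarted^[j] X) 0 ω = l} :=
      (hX.iterate hP hr j).measurable_restarted 0 (measurableSet_singleton l)
    have h := (hX.restrict_restartHistory hP hr k t
      (Nat.lt_of_succ_lt hj).le).real_sliceSet_inter hP hr (k ⟨j, Nat.lt_of_succ_lt hj⟩) l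
      (s := (t ⟨j, Nat.lt_of_succ_lt hj⟩ : ℝ≥0))
      (t := ((t ⟨j, Nat.lt_of_succ_lt hj⟩ + 1 : ℕ) : ℝ≥0)) (by gcongr; exact Nat.le_succ _)
      (L := []) (by simp)
    simp only [Follows, and_true, pathWeight, mul_one] at h
    rw [measureReal_restrict_apply (hml.inter hms), measureReal_restrict_apply hms,
      Set.inter_assoc, ← hs, Set.inter_comm] at h
    rw [← Function.iterate_succ_apply' restarted] at h
    simpa [previous, entryProb] using h

theorem HasMarkovLaw.real_restartHistory_inter_slice (hX : HasMarkovLaw μ P X)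
    (hP : IsTransitionFunction P) (hr : ∀ k, 0 < exitRate P k) {n : ℕ} (k : Fin n → E)
    (t : Fin n → ℕ) (j : Fin n) (l : E) {a b : ℝ≥0} (hab : a ≤ b) :
    μ.real (restartHistory X k t j ∩ sliceSet (restarted^[j] X) l a b) =
      μ.real (restartHistory X k t j ∩ {ω | restarted^[j] X 0 ω = l}) *
        (Real.exp (-exitRate P l * a) - Real.exp (-exitRate P l * b)) := by
  have hml : MeasurableSet {ω | restarted^[j] X 0 ω = l} :=
    (hX.iterate hP hr j).measurable 0 (measurableSet_singleton l)
  have h := (hX.restrict_restartHistory hP hr k t j.2.le).real_sliceSet hP hr l hab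
  rwa [measureReal_restrict_apply ((hX.iterate hP hr j).measurableSet_sliceSet _ _ _),
    measureReal_restrict_apply hml, Set.inter_comm, Set.inter_comm {ω | _}] at h

theorem exp_neg_mul_lt_one {r : ℝ} (hr : 0 < r) {T : ℕ} (hT : 0 < T) :
    Real.exp (-r * T) < 1 := by
  rw [Real.exp_lt_one_iff]
  have : (0 : ℝ) < T := by exact_mod_cast hT
  nlinarith

/-- The amplitudes are those of a Markov chain with independent truncated exponential holding
times. -/
theorem HasMarkovLaw.amplitude_eq {μ : Measure Ω} [IsProbabilityMeasure μ]
    (hX : HasMarkovLaw μ P X)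
    (hP : IsTransitionFunction P) (hr : ∀ k, 0 < exitRate P k) {n : ℕ} (k : Fin n → E)
    (t : Fin n → ℕ) {T : ℕ} (ht : ∀ j, t j < T) :
    amplitude μ X T k t = ∏ j, (Real.sqrt (entryProb μ P X (previous k j) (k j)) *
      Real.sqrt (sliceProb (exitRate P (k j)) T (t j))) := by
  have hae := hX.ae_pieces_eq hP hr
  have hH : ∀ j : Fin n, historyEvent X k t j =ᵐ[μ] restartHistory X k t j := by
    intro j
    filter_upwards [hae] with ω hω
    refine propext ?_
    change ω ∈ historyEvent X k t j ↔ ω ∈ restartHistory X k t j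
    simp only [historyEvent, restartHistory, stateEvent, sliceEvent, sliceSet, Set.mem_ofPred_eq,
      Set.mem_inter_iff, hω, Fin.lt_def, ENNReal.coe_natCast, Nat.cast_add, Nat.cast_one,
      ENNReal.coe_add, ENNReal.coe_one]
  have hS : ∀ j : Fin n, stateEvent X j (k j) =ᵐ[μ] {ω | restarted^[j] X 0 ω = k j} := by
    intro j
    filter_upwards [hae] with ω hω
    refine propext ?_
    change ω ∈ stateEvent X j (k j) ↔ ω ∈ {ω | _}
    simp only [stateEvent, Set.mem_ofPred_eq, hω]
  have hHm := fun j : ℕ => hX.measurableSet_restartHistory hP hr k t j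
  have hA : ∀ j : Fin n, (ProbabilityTheory.cond μ (historyEvent X k t j)).real
      (stateEvent X j (k j)) = μ.real (restartHistory X k t j ∩
        {ω | restarted^[j] X 0 ω = k j}) / μ.real (restartHistory X k t j) := by
    intro j
    rw [cond_real_eq_div ((hHm j).nullMeasurableSet.congr (hH j).symm),
      measureReal_congr (hH j), measureReal_congr ((hH j).inter (hS j))]
  have hHS : ∀ j : Fin n, (historyEvent X k t j ∩ stateEvent X j (k j) ∩ truncEvent X j T : Set Ω)
      =ᵐ[μ] (restartHistory X k t j ∩
        sliceSet (restarted^[j] X) (k j) (0 : ℝ≥0) (T : ℝ≥0) : Set Ω) := by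
    intro j
    filter_upwards [hae, hH j] with ω hω hHω
    refine propext ?_
    have hHω : ω ∈ historyEvent X k t j ↔ ω ∈ restartHistory X k t j := iff_of_eq hHω
    change ω ∈ historyEvent X k t j ∩ stateEvent X j (k j) ∩ truncEvent X j T ↔
      ω ∈ restartHistory X k t j ∩ _
    simp only [stateEvent, truncEvent, sliceSet, Set.mem_ofPred_eq, Set.mem_inter_iff, hω, hHω,
      ENNReal.coe_natCast, ENNReal.coe_zero, zero_le, true_and, and_assoc]
  have hHT : ∀ j : Fin n, (historyEvent X k t j ∩ stateEvent X j (k j) ∩ truncEvent X j T ∩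
      sliceEvent X j (t j) : Set Ω) =ᵐ[μ] (restartHistory X k t j ∩
        sliceSet (restarted^[j] X) (k j) (t j : ℝ≥0) ((t j + 1 : ℕ) : ℝ≥0) : Set Ω) := by
    intro j
    filter_upwards [hae, hH j] with ω hω hHω
    refine propext ?_
    have hHω : ω ∈ historyEvent X k t j ↔ ω ∈ restartHistory X k t j := iff_of_eq hHω
    have hle : ((t j : ℝ≥0∞) + 1) ≤ T := by exact_mod_cast ht j
    change ω ∈ historyEvent X k t j ∩ stateEvent X j (k j) ∩ truncEvent X j T ∩ sliceEvent X j (t j)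
      ↔ ω ∈ restartHistory X k t j ∩ _
    simp only [stateEvent, truncEvent, sliceEvent, sliceSet, Set.mem_ofPred_eq, Set.mem_inter_iff,
      hω, hHω, ENNReal.coe_natCast, Nat.cast_add, Nat.cast_one, ENNReal.coe_add, ENNReal.coe_one]
    constructor
    · rintro ⟨⟨⟨h1, h2⟩, -⟩, h3⟩
      exact ⟨h1, h2, h3⟩
    · rintro ⟨h1, h2, h3⟩
      exact ⟨⟨⟨h1, h2⟩, h3.2.trans_le hle⟩, h3⟩
  have hB : ∀ j : Fin n, μ.real (restartHistory X k t j ∩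
        {ω | restarted^[j] X 0 ω = k j}) ≠ 0 →
      (ProbabilityTheory.cond μ (historyEvent X k t j ∩ stateEvent X j (k j) ∩
        truncEvent X j T)).real (sliceEvent X j (t j)) =
          sliceProb (exitRate P (k j)) T (t j) := by
    intro j hj
    rw [cond_real_eq_div (NullMeasurableSet.congr ((hHm j).inter
      ((hX.iterate hP hr j).measurableSet_sliceSet _ _ _)).nullMeasurableSet (hHS j).symm),
      measureReal_congr (hHS j), measureReal_congr (hHT j),
      hX.real_restartHistory_inter_slice hP hr k t j _ (by gcongr; exact Nat.le_succ _),
      hX.real_restartHistory_inter_slice hP hr k t j _ zero_le, mul_div_mul_left _ _ hj]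
    simp [sliceProb]
  -- If all these events have positive mass, the quotients cancel factor by factor; otherwise both
  -- products turn out to be 0.
  by_cases hall : ∀ j : Fin n, μ.real (restartHistory X k t j ∩
        {ω | restarted^[j] X 0 ω = k j}) ≠ 0
  · refine Finset.prod_congr rfl fun j _ => ?_
    rw [hA, hB j (hall j)]
    have hj := hall j
    rw [hX.real_restartHistory_inter_state hP hr] at hj ⊢
    rw [mul_div_cancel_left₀ _ (left_ne_zero_of_mul hj)]
  · push Not at hall
    obtain ⟨j, hj⟩ := hall
    trans 0
    · refine Finset.prod_eq_zero (Finset.mem_univ j) ?_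
      rw [hA, hj]
      simp
    · by_contra hne
      have hentry : ∀ j, entryProb μ P X (previous k j) (k j) ≠ 0 := by
        intro i hi
        refine hne (Finset.prod_eq_zero (Finset.mem_univ i) ?_).symm
        rw [hi]
        simp
      -- Every unit slice has positive exponential mass, so nonzero entry probabilities would keep
      -- all histories non-null, contradicting `hj`.
      have hpos : ∀ i : ℕ, i ≤ n → μ.real (restartHistory X k t i) ≠ 0 := by
        intro i
        induction i with
        | zero => simp [restartHistory]
        | succ i ih =>
          intro hi
          have hs := restartHistory_succ X k t ⟨i, hi⟩
          have h1 := hX.real_restartHistory_inter_slice hP hr k t ⟨i, hi⟩ (k ⟨i, hi⟩)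
            (a := (t ⟨i, hi⟩ : ℝ≥0)) (b := ((t ⟨i, hi⟩ + 1 : ℕ) : ℝ≥0))
            (by gcongr; exact Nat.le_succ _)
          rw [Set.inter_comm, ← hs, hX.real_restartHistory_inter_state hP hr] at h1
          rw [h1]
          refine mul_ne_zero (mul_ne_zero (ih (Nat.le_of_succ_le hi)) (hentry _))
            (sub_pos.2 (Real.exp_lt_exp.2 ?_)).ne'
          have := hr (k ⟨i, hi⟩)
          push_cast
          linarith
      rw [hX.real_restartHistory_inter_state hP hr] at hj
      exact mul_ne_zero (hpos j j.2.le) (hentry j) hj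

/-- Given that the `j`-th piece is in the state `k`, its holding time is exponential. -/
theorem HasMarkovLaw.cond_holdingTime (hX : HasMarkovLaw μ P X)
    (hP : IsTransitionFunction P) (hr : ∀ k, 0 < exitRate P k) (j : ℕ) (k : E)
    (hk : μ (stateEvent X j k) ≠ 0) (t : ℝ≥0) :
    (ProbabilityTheory.cond μ (stateEvent X j k)).real
      {ω | (t : ℝ≥0∞) ≤ holdingTime (fun u => X u ω) j} = Real.exp (-exitRate P k * t) := by
  have hae := hX.ae_pieces_eq hP hr
  have hS : stateEvent X j k =ᵐ[μ] {ω | restarted^[j] X 0 ω = k} := by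
    filter_upwards [hae] with ω hω
    refine propext ?_
    change ω ∈ stateEvent X j k ↔ ω ∈ {ω | _}
    simp only [stateEvent, Set.mem_ofPred_eq, hω]
  have hST : (stateEvent X j k ∩ {ω | (t : ℝ≥0∞) ≤ holdingTime (fun u => X u ω) j} : Set Ω)
      =ᵐ[μ] {ω | restarted^[j] X 0 ω = k ∧ t ≤ firstHold (restarted^[j] X) ω} := by
    filter_upwards [hae] with ω hω
    refine propext ?_
    change ω ∈ stateEvent X j k ∩ {ω | _} ↔ ω ∈ {ω | _}
    simp only [stateEvent, Set.mem_ofPred_eq, Set.mem_inter_iff, hω]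
  have hm : MeasurableSet {ω | restarted^[j] X 0 ω = k} :=
    (hX.iterate hP hr j).measurable 0 (measurableSet_singleton k)
  rw [cond_real_eq_div (hm.nullMeasurableSet.congr hS.symm), measureReal_congr hST,
    (hX.iterate hP hr j).real_le_firstHold hP hr, measureReal_congr hS]
  refine mul_div_cancel_left₀ _ ?_
  rw [← measureReal_congr hS]
  exact ENNReal.toReal_ne_zero.2 ⟨hk, measure_ne_top _ _⟩

end Amplitude

/-! ### Action of gate sequences on basis vectors -/

section Gates

variable {Q : Type*} [Fintype Q] [DecidableEq Q]

/-- The linear map implemented by a sequence of gates; the first gate acts first. -/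
def runGates : List (Gate Q) → ((Q → Bool) → ℂ) →ₗ[ℂ] ((Q → Bool) → ℂ)
  | [] => LinearMap.id
  | g :: gs => runGates gs ∘ₗ g.matrix.mulVecLin

theorem runGates_append (gs hs : List (Gate Q)) (v : (Q → Bool) → ℂ) :
    runGates (gs ++ hs) v = runGates hs (runGates gs v) := by
  induction gs generalizing v with
  | nil => rfl
  | cons g gs ih => exact ih _

theorem Circuit.unitary_mulVec (c : Circuit Q) (v : (Q → Bool) → ℂ) :
    c.unitary.val *ᵥ v = runGates c.layers.flatten v := by
  unfold Circuit.unitary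
  generalize c.layers.flatten = gs
  induction gs generalizing v with
  | nil => simp [runGates]
  | cons g gs ih =>
    rw [List.map_cons, List.reverse_cons, List.prod_append, List.prod_singleton,
      Submonoid.coe_mul, ← Matrix.mulVec_mulVec, ih]
    rfl

theorem runGates_singleton_ket_of_not_fires {g : Gate Q} {b : Q → Bool} (h : ¬ g.Fires b) :
    runGates [g] (ket b) = ket b := by
  change g.matrix *ᵥ Pi.single b 1 = Pi.single b 1
  rw [Matrix.mulVec_single_one]
  ext a
  simp [Gate.matrix, h, Pi.single_apply]

theorem runGates_singleton_ket_of_fires {g : Gate Q} {b : Q → Bool} (h : g.Fires b)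
    (hb : b g.target = false) :
    runGates [g] (ket b) = (Real.cos g.angle : ℂ) • ket b +
      (Real.sin g.angle : ℂ) • ket (Function.update b g.target true) := by
  change g.matrix *ᵥ Pi.single b 1 = _ • Pi.single b 1 + _ • Pi.single _ 1
  rw [Matrix.mulVec_single_one]
  ext a
  have h1 : Function.update b g.target false = b := by rw [← hb, Function.update_eq_self]
  by_cases hat : a g.target = true
  · have : a ≠ b := by rintro rfl; simp [hb] at hat
    simp [Gate.matrix, h, hat, hb, rotEntry, Pi.single_apply, this, eq_comm]
  · have hat : a g.target = false := by simpa using hat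
    have : a ≠ Function.update b g.target true := by
      rintro rfl; simp at hat
    simp [Gate.matrix, h, hat, hb, rotEntry, Pi.single_apply, this, h1, eq_comm]

/-- The gates `gs` do nothing unless the qubits of `K` are in the states prescribed by `c`. -/
def ControlledBy (K : Finset Q) (c : Q → Bool) (gs : List (Gate Q)) : Prop :=
  ∀ g ∈ gs, ∀ b : Q → Bool, (∃ q ∈ K, b q ≠ c q) → ¬ g.Fires b

theorem ControlledBy.runGates_ket {K : Finset Q} {c : Q → Bool} {gs : List (Gate Q)}
    (h : ControlledBy K c gs) {b : Q → Bool} (hb : ∃ q ∈ K, b q ≠ c q) :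
    runGates gs (ket b) = ket b := by
  induction gs with
  | nil => rfl
  | cons g gs ih =>
    rw [← List.singleton_append, runGates_append,
      runGates_singleton_ket_of_not_fires (h g (by simp) b hb),
      ih fun g' hg' => h g' (by simp [hg'])]

theorem runGates_flatMap_of_mismatch {ι : Type*} {K : Finset Q} {c : ι → Q → Bool}
    {G : ι → List (Gate Q)} (hG : ∀ i, ControlledBy K (c i) (G i)) {l : List ι} {b : Q → Bool}
    (hb : ∀ i ∈ l, ∃ q ∈ K, b q ≠ c i q) : runGates (l.flatMap G) (ket b) = ket b := by
  induction l with
  | nil => rfl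
  | cons i l ih =>
    rw [List.flatMap_cons, runGates_append, (hG i).runGates_ket (hb i (by simp)),
      ih fun j hj => hb j (by simp [hj])]

/-- Of a sequence of operations with mutually exclusive controls only the one whose control
pattern is present acts. -/
theorem runGates_flatMap_of_mem {ι α : Type*} {K : Finset Q} {c : ι → Q → Bool}
    {G : ι → List (Gate Q)} (hG : ∀ i, ControlledBy K (c i) (G i)) {l : List ι} (hl : l.Nodup)
    (hc : ∀ i ∈ l, ∀ j ∈ l, i ≠ j → ∃ q ∈ K, c i q ≠ c j q) {i : ι} (hi : i ∈ l)
    {b : Q → Bool} (hb : ∀ q ∈ K, b q = c i q) {A : Finset α} {w : α → ℂ} {B : α → Q → Bool}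
    (hrun : runGates (G i) (ket b) = ∑ a ∈ A, w a • ket (B a))
    (hB : ∀ a, ∀ q ∈ K, B a q = c i q) :
    runGates (l.flatMap G) (ket b) = ∑ a ∈ A, w a • ket (B a) := by
  induction l with
  | nil => simp at hi
  | cons j l ih =>
    rw [List.nodup_cons] at hl
    have hmis : ∀ j' ∈ j :: l, i ≠ j' → ∀ b' : Q → Bool, (∀ q ∈ K, b' q = c i q) →
        ∃ q ∈ K, b' q ≠ c j' q := by
      intro j' hj' hne b' hb'
      obtain ⟨q, hq, hqne⟩ := hc i hi j' hj' hne
      exact ⟨q, hq, by rwa [hb' q hq]⟩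
    rw [List.flatMap_cons, runGates_append]
    rcases eq_or_ne i j with rfl | hij
    · rw [hrun, map_sum]
      refine Finset.sum_congr rfl fun a _ => ?_
      rw [map_smul, runGates_flatMap_of_mismatch hG]
      intro j' hj'
      exact hmis j' (by simp [hj']) (by rintro rfl; exact hl.1 hj') _ (hB a)
    · rw [(hG j).runGates_ket (hmis j (by simp) hij b hb)]
      exact ih hl.2 (fun i hi j hj => hc i (by simp [hi]) j (by simp [hj]))
        (by simpa [hij] using hi)

end Gates

/-! ### Preparing superpositions on a register -/

section Registers

variable {Q : Type*} {s : ℕ}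

/-- The bit string `b` with the register `r` overwritten by the binary digits of `k`. -/
def writeReg (r : Fin s → Q) (k : ℕ) (b : Q → Bool) : Q → Bool :=
  Function.extend r (fun i => k.testBit i) b

variable {r : Fin s → Q}

theorem writeReg_apply (hr : r.Injective) (k : ℕ) (b : Q → Bool) (i : Fin s) :
    writeReg r k b (r i) = k.testBit i :=
  hr.extend_apply _ _ _

theorem writeReg_of_notMem {q : Q} (hq : ∀ i, r i ≠ q) (k : ℕ) (b : Q → Bool) :
    writeReg r k b q = b q :=
  Function.extend_apply' _ _ _ fun ⟨i, hi⟩ => hq i hi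

theorem writeReg_zero (hr : r.Injective) {b : Q → Bool} (hb : ∀ i, b (r i) = false) :
    writeReg r 0 b = b := by
  funext q
  by_cases hq : ∃ i, r i = q
  · obtain ⟨i, rfl⟩ := hq
    simp [writeReg_apply hr, hb]
  · exact writeReg_of_notMem (fun i hi => hq ⟨i, hi⟩) _ _

theorem exists_testBit_ne {k l : ℕ} (hk : k < 2 ^ s) (hl : l < 2 ^ s) (h : k ≠ l) :
    ∃ i : Fin s, k.testBit i ≠ l.testBit i := by
  by_contra! hall
  refine h (Nat.eq_of_testBit_eq fun i => ?_)
  by_cases hi : i < s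
  · exact hall ⟨i, hi⟩
  · have : 2 ^ s ≤ 2 ^ i := Nat.pow_le_pow_right two_pos (not_lt.1 hi)
    rw [Nat.testBit_lt_two_pow (hk.trans_le this), Nat.testBit_lt_two_pow (hl.trans_le this)]

theorem update_writeReg [DecidableEq Q] (hr : r.Injective) {k l : ℕ} {i : Fin s}
    (hl : l.testBit i = true) (h : ∀ j : Fin s, j ≠ i → k.testBit j = l.testBit j)
    (b : Q → Bool) : Function.update (writeReg r k b) (r i) true = writeReg r l b := by
  funext q
  by_cases hq : ∃ j, r j = q
  · obtain ⟨j, rfl⟩ := hq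
    rcases eq_or_ne j i with rfl | hji
    · simp [writeReg_apply hr, hl]
    · rw [Function.update_of_ne (hr.ne hji), writeReg_apply hr, writeReg_apply hr, h j hji]
  · have hq' : ∀ j, r j ≠ q := fun j hj => hq ⟨j, hj⟩
    rw [Function.update_of_ne (hq' i).symm, writeReg_of_notMem hq', writeReg_of_notMem hq']

theorem exists_angle (a b : ℝ) :
    ∃ θ, Real.sqrt (a ^ 2 + b ^ 2) * Real.cos θ = a ∧
      Real.sqrt (a ^ 2 + b ^ 2) * Real.sin θ = b := by
  refine ⟨Complex.arg (a + b * Complex.I), ?_, ?_⟩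
  · rw [← Complex.norm_add_mul_I, Complex.norm_mul_cos_arg]; simp
  · rw [← Complex.norm_add_mul_I, Complex.norm_mul_sin_arg]; simp

variable [Fintype Q] [DecidableEq Q]

/-- Induction on the largest index: its weight is first merged into an index differing from it in
one bit, and a last controlled rotation splits the two. This costs exactly one gate per index beyond
0. -/
theorem exists_prepare_range (hr : r.Injective) (K : Finset Q) (hK : ∀ q ∈ K, ∀ i, r i ≠ q)
    (c : Q → Bool) (p : ℕ) (hp : p < 2 ^ s) (β : ℕ → ℝ) (hβ : ∀ k, 0 ≤ β k) :
    ∃ gs : List (Gate Q), gs.length = p ∧ ControlledBy K c gs ∧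
      ∀ b : Q → Bool, (∀ q ∈ K, b q = c q) →
        runGates gs ((Real.sqrt (∑ k ∈ Finset.range (p + 1), β k ^ 2) : ℂ) •
          ket (writeReg r 0 b)) =
            ∑ k ∈ Finset.range (p + 1), (β k : ℂ) • ket (writeReg r k b) := by
  induction p generalizing β with
  | zero =>
    refine ⟨[], rfl, by simp [ControlledBy], fun b _ => ?_⟩
    simp [runGates, Real.sqrt_sq (hβ 0)]
  | succ p ih =>
    -- Clearing a set bit of `p + 1` gives a smaller index `p'`, which is therefore already present.
    obtain ⟨i, hi⟩ := Nat.exists_testBit_of_ne_zero (Nat.succ_ne_zero p)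
    have his : i < s := by
      by_contra h
      rw [Nat.testBit_lt_two_pow (hp.trans_le (Nat.pow_le_pow_right two_pos (not_lt.1 h)))] at hi
      exact absurd hi (by simp)
    set i' : Fin s := ⟨i, his⟩
    set p' := (p + 1) ^^^ 2 ^ i with hp'
    have hbit : ∀ j, p'.testBit j = ((p + 1).testBit j ^^ decide (i = j)) := fun j => by
      rw [hp', Nat.testBit_xor, Nat.testBit_two_pow]
    have hbi : p'.testBit i = false := by simp [hbit, hi]
    have hbj : ∀ j, j ≠ i → p'.testBit j = (p + 1).testBit j := fun j hj => by
      simp [hbit, hj.symm]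
    have hlt : p' < p + 1 :=
      Nat.lt_of_testBit i hbi hi fun j hj => hbj j hj.ne'
    obtain ⟨θ, hcos, hsin⟩ := exists_angle (β p') (β (p + 1))
    set R := Real.sqrt (β p' ^ 2 + β (p + 1) ^ 2)
    obtain ⟨gs, hlen, hctl, hrun⟩ := ih (Nat.lt_of_succ_lt hp) (Function.update β p' R) (by
      intro k
      by_cases hk : k = p'
      · subst hk; simp [R]
      · simpa [Function.update_of_ne hk] using hβ k)
    have hnot : r i' ∉ K ∪ (Finset.univ.image r).erase (r i') := by
      simp only [Finset.mem_union, Finset.mem_erase, ne_eq, not_true_eq_false, false_and, or_false]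
      exact fun h => hK _ h i' rfl
    set g : Gate Q :=
      { controls := K ∪ (Finset.univ.image r).erase (r i')
        pattern := writeReg r (p + 1) c
        target := r i'
        angle := θ
        target_notMem := hnot } with hg
    have hpat : ∀ q ∈ K, g.pattern q = c q := fun q hq => writeReg_of_notMem (hK q hq) _ _
    have hpr : ∀ j : Fin s, g.pattern (r j) = (p + 1).testBit j := writeReg_apply hr _ _
    have hfires : ∀ b : Q → Bool, (∀ q ∈ K, b q = c q) → ∀ k, g.Fires (writeReg r k b) ↔
        ∀ j : Fin s, j ≠ i' → k.testBit j = (p + 1).testBit j := by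
      intro b hb k
      constructor
      · intro h j hj
        have := h (r j) (by simp [hg, hr.ne hj])
        rwa [writeReg_apply hr, hpr] at this
      · intro h q hq
        rcases Finset.mem_union.1 hq with hq | hq
        · rw [hpat q hq, writeReg_of_notMem (hK q hq), hb q hq]
        · obtain ⟨hne, hq⟩ := Finset.mem_erase.1 hq
          obtain ⟨j, -, rfl⟩ := Finset.mem_image.1 hq
          rw [writeReg_apply hr, hpr]
          exact h j fun hji => hne (by rw [hji])
    refine ⟨gs ++ [g], by simp [hlen], ?_, fun b hb => ?_⟩
    · intro g' hg' b ⟨q, hq, hne⟩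
      rcases List.mem_append.1 hg' with h | h
      · exact hctl g' h b ⟨q, hq, hne⟩
      · rw [List.mem_singleton.1 h]
        exact fun hf => hne ((hf q (by simp [hg, hq])).trans (hpat q hq))
    · have hmem : p' ∈ Finset.range (p + 1) := Finset.mem_range.2 hlt
      have hsum : ∑ k ∈ Finset.range (p + 1), Function.update β p' R k ^ 2 =
          ∑ k ∈ Finset.range (p + 1 + 1), β k ^ 2 := by
        rw [Finset.sum_range_succ _ (p + 1), ← Finset.add_sum_erase _ _ hmem,
          ← Finset.add_sum_erase _ (fun k => β k ^ 2) hmem]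
        have : ∑ k ∈ (Finset.range (p + 1)).erase p', Function.update β p' R k ^ 2 =
            ∑ k ∈ (Finset.range (p + 1)).erase p', β k ^ 2 :=
          Finset.sum_congr rfl fun k hk => by
            rw [Function.update_of_ne (Finset.ne_of_mem_erase hk)]
        rw [this, Function.update_self, Real.sq_sqrt (by positivity)]
        ring
      have hother : ∀ k ∈ (Finset.range (p + 1)).erase p',
          runGates [g] (ket (writeReg r k b)) = ket (writeReg r k b) := by
        intro k hk
        refine runGates_singleton_ket_of_not_fires fun hf => ?_
        rw [hfires b hb] at hf
        obtain ⟨hne, hk⟩ := Finset.mem_erase.1 hk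
        have hk := Finset.mem_range.1 hk
        -- An index that fires the gate agrees with `p + 1` off bit `i`. Differing from both `p + 1`
        -- and `p'`, it would need a third value for that bit.
        obtain ⟨j, hj⟩ := exists_testBit_ne (hk.trans hp) hp hk.ne
        obtain ⟨j', hj'⟩ := exists_testBit_ne (hk.trans hp) (hlt.trans hp) hne
        have hji : j = i' := by
          by_contra h; exact hj (hf j h)
        have hji' : j' = i' := by
          by_contra h
          exact hj' ((hf j' h).trans (hbj j' fun h' => h (Fin.ext h')).symm)
        subst hji
        rw [hji'] at hj'
        change k.testBit i ≠ (p + 1).testBit i at hj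
        change k.testBit i ≠ p'.testBit i at hj'
        rw [hi] at hj
        rw [hbi] at hj'
        cases h : k.testBit i <;> simp_all
      have hmain : runGates [g] (ket (writeReg r p' b)) =
          (Real.cos θ : ℂ) • ket (writeReg r p' b) +
            (Real.sin θ : ℂ) • ket (writeReg r (p + 1) b) := by
        have hbj' : ∀ j : Fin s, j ≠ i' → p'.testBit j = (p + 1).testBit j :=
          fun j hj => hbj j fun h => hj (Fin.ext h)
        rw [runGates_singleton_ket_of_fires ((hfires b hb p').2 hbj')]
        · rw [update_writeReg hr (i := i') hi hbj']
        · exact (writeReg_apply hr _ _ _).trans hbi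
      rw [runGates_append, ← hsum, hrun b hb, map_sum, Finset.sum_range_succ _ (p + 1),
        ← Finset.add_sum_erase _ _ hmem, ← Finset.add_sum_erase (Finset.range (p + 1))
          (fun k => (β k : ℂ) • ket (writeReg r k b)) hmem]
      have : ∑ k ∈ (Finset.range (p + 1)).erase p',
          runGates [g] ((Function.update β p' R k : ℂ) • ket (writeReg r k b)) =
            ∑ k ∈ (Finset.range (p + 1)).erase p', (β k : ℂ) • ket (writeReg r k b) :=
        Finset.sum_congr rfl fun k hk => by
          rw [map_smul, hother k hk, Function.update_of_ne (Finset.ne_of_mem_erase hk)]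
      rw [this, Function.update_self, map_smul, hmain, smul_add, smul_smul, smul_smul,
        ← Complex.ofReal_mul, ← Complex.ofReal_mul, hcos, hsin]
      abel

/-- A product state needs no controls inside the register: the rotations share the outside controls
`K` and have distinct targets, so they form a single layer. -/
theorem exists_prepare_bits {m : ℕ} {r : Fin m → Q} (hr : r.Injective) (K : Finset Q)
    (hK : ∀ q ∈ K, ∀ i, r i ≠ q) (c : Q → Bool) (θ : ℕ → ℝ) (p : ℕ) (hp : p ≤ m) :
    ∃ gs : List (Gate Q), gs.length = p ∧ gs.Pairwise Gate.Compatible ∧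
      (∀ g ∈ gs, g.controls = K ∧ g.pattern = c ∧ ∃ i : Fin m, (i : ℕ) < p ∧ g.target = r i) ∧
      ∀ b : Q → Bool, (∀ q ∈ K, b q = c q) →
        runGates gs (ket (writeReg r 0 b)) = ∑ t ∈ Finset.range (2 ^ p),
          ((∏ i ∈ Finset.range p,
            if t.testBit i then Real.sin (θ i) else Real.cos (θ i) : ℝ) : ℂ) •
              ket (writeReg r t b) := by
  induction p with
  | zero => exact ⟨[], rfl, List.Pairwise.nil, by simp, by simp [runGates]⟩
  | succ p ih =>
    obtain ⟨gs, hlen, hpw, hgs, hrun⟩ := ih (Nat.le_of_succ_le hp)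
    set i : Fin m := ⟨p, hp⟩ with hi
    set g : Gate Q :=
      { controls := K
        pattern := c
        target := r i
        angle := θ p
        target_notMem := fun h => hK _ h i rfl } with hg
    refine ⟨gs ++ [g], by simp [hlen], ?_, ?_, fun b hb => ?_⟩
    · refine List.pairwise_append.2 ⟨hpw, List.pairwise_singleton _ _, ?_⟩
      intro g1 h1 g2 h2
      rw [List.mem_singleton.1 h2]
      obtain ⟨hc, -, j, hj, ht⟩ := hgs g1 h1
      refine ⟨?_, ?_, ?_⟩
      · rw [ht]
        exact hr.ne fun h => by rw [h] at hj; exact lt_irrefl _ hj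
      · rw [ht]; exact fun h => hK _ h j rfl
      · rw [hc]; exact fun h => hK _ h i rfl
    · intro g' hg'
      rcases List.mem_append.1 hg' with h | h
      · obtain ⟨h1, h2, j, hj, ht⟩ := hgs g' h
        exact ⟨h1, h2, j, hj.trans p.lt_succ_self, ht⟩
      · rw [List.mem_singleton.1 h]
        exact ⟨rfl, rfl, i, p.lt_succ_self, rfl⟩
    · rw [runGates_append, hrun b hb, map_sum, pow_succ, mul_two, Finset.sum_range_add,
        ← Finset.sum_add_distrib]
      refine Finset.sum_congr rfl fun t ht => ?_
      have ht := Finset.mem_range.1 ht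
      have hf : g.Fires (writeReg r t b) := fun q hq => by
        rw [writeReg_of_notMem (hK q hq), hb q hq]
      have hbit : t.testBit p = false := Nat.testBit_lt_two_pow ht
      have hbit' : (2 ^ p + t).testBit p = true := by
        rw [Nat.testBit_two_pow_add_eq, hbit]; rfl
      have hprod : (∏ j ∈ Finset.range p,
          if (2 ^ p + t).testBit j then Real.sin (θ j) else Real.cos (θ j)) =
          ∏ j ∈ Finset.range p, if t.testBit j then Real.sin (θ j) else Real.cos (θ j) :=
        Finset.prod_congr rfl fun j hj => by
          rw [Nat.testBit_two_pow_add_gt (Finset.mem_range.1 hj)]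
      have hup : ∀ j : Fin m, j ≠ i → t.testBit j = (2 ^ p + t).testBit j := by
        intro j hj
        rcases lt_or_ge (j : ℕ) p with h | h
        · exact (Nat.testBit_two_pow_add_gt h t).symm
        · have h : p + 1 ≤ j := Nat.lt_of_le_of_ne h fun h' => hj (Fin.ext h'.symm)
          have h2 : 2 ^ (p + 1) ≤ 2 ^ (j : ℕ) := Nat.pow_le_pow_right two_pos h
          rw [Nat.testBit_lt_two_pow (by omega), Nat.testBit_lt_two_pow (by omega)]
      rw [map_smul, runGates_singleton_ket_of_fires hf
        ((writeReg_apply hr _ _ _).trans hbit), update_writeReg hr (i := i) hbit' hup,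
        Finset.prod_range_succ, Finset.prod_range_succ, hbit, hbit', hprod]
      simp [smul_smul, smul_add, hg]

end Registers

/-! ### Truncated exponential laws have independent binary digits -/

section Slices

/-- A truncated exponential law makes the binary digits of the time slice independent. -/
theorem sliceProb_two_pow {r : ℝ} (hr : 0 < r) (m t : ℕ) (ht : t < 2 ^ m) :
    sliceProb r (2 ^ m) t = ∏ i ∈ Finset.range m,
      (if t.testBit i then Real.exp (-r) ^ 2 ^ i else 1) / (1 + Real.exp (-r) ^ 2 ^ i) := by
  set y := Real.exp (-r) with hy
  have hexp : ∀ k : ℕ, Real.exp (-r * k) = y ^ k := fun k => by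
    rw [hy, ← Real.exp_nat_mul, mul_comm]
  have hy0 : 0 < y := Real.exp_pos _
  have hy1 : y < 1 := by rw [hy, Real.exp_lt_one_iff]; linarith
  have hne : ∀ m, 1 - y ^ 2 ^ m ≠ 0 := fun m =>
    (sub_pos.2 (pow_lt_one₀ hy0.le hy1 (by positivity))).ne'
  simp only [sliceProb, hexp]
  induction m generalizing t with
  | zero =>
    obtain rfl : t = 0 := by simpa using ht
    have := hne 0
    simp only [pow_zero, pow_one] at this
    simp [this]
  | succ m ih =>
    -- The new factor of the normalization belongs to the top digit, which contributes y^(2^m) to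
    -- the numerator exactly when it is set.
    have hsq : 1 - y ^ 2 ^ (m + 1) = (1 - y ^ 2 ^ m) * (1 + y ^ 2 ^ m) := by ring
    have hpos : 1 + y ^ 2 ^ m ≠ 0 := by positivity
    have := hne m
    rw [Finset.prod_range_succ, hsq]
    rcases lt_or_ge t (2 ^ m) with h | h
    · rw [← ih t h, Nat.testBit_lt_two_pow h]
      field_simp
      simp
    · obtain ⟨t, rfl⟩ := Nat.exists_eq_add_of_le h
      have h' : t < 2 ^ m := by rw [pow_succ] at ht; omega
      have hprod : ∀ i ∈ Finset.range m,
          (if (2 ^ m + t).testBit i then y ^ 2 ^ i else 1) / (1 + y ^ 2 ^ i) =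
            (if t.testBit i then y ^ 2 ^ i else 1) / (1 + y ^ 2 ^ i) := fun i hi => by
        rw [Nat.testBit_two_pow_add_gt (Finset.mem_range.1 hi)]
      rw [Finset.prod_congr rfl hprod, ← ih t h', Nat.testBit_two_pow_add_eq,
        Nat.testBit_lt_two_pow h']
      simp only [Bool.not_false, if_true, pow_add]
      field_simp

theorem sum_sliceProb {r : ℝ} (hr : 0 < r) {T : ℕ} (hT : 0 < T) :
    ∑ t : Fin T, sliceProb r T t = 1 := by
  rw [Finset.sum_fin_eq_sum_range]
  have h := Finset.sum_range_sub' (fun t : ℕ => Real.exp (-r * t)) T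
  rw [Finset.sum_congr rfl (g := fun t : ℕ => (Real.exp (-r * t) - Real.exp (-r * (t + 1 : ℕ))) /
    (1 - Real.exp (-r * T))), ← Finset.sum_div, h]
  · rw [Nat.cast_zero, mul_zero, Real.exp_zero,
      div_self (sub_pos.2 (exp_neg_mul_lt_one hr hT)).ne']
  · intro t ht
    rw [dif_pos (Finset.mem_range.1 ht)]
    rfl

theorem sliceProb_nonneg {r : ℝ} (hr : 0 < r) {T : ℕ} (hT : 0 < T) (t : ℕ) :
    0 ≤ sliceProb r T t := by
  refine div_nonneg (sub_nonneg.2 (Real.exp_le_exp.2 ?_))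
    (sub_pos.2 (exp_neg_mul_lt_one hr hT)).le
  push_cast
  linarith

/-- Rotation angles preparing the digits of a truncated exponential law. -/
theorem exists_slice_angles {r : ℝ} (hr : 0 < r) (m : ℕ) : ∃ θ : ℕ → ℝ, ∀ t < 2 ^ m,
    Real.sqrt (sliceProb r (2 ^ m) t) = ∏ i ∈ Finset.range m,
      if t.testBit i then Real.sin (θ i) else Real.cos (θ i) := by
  have h : ∀ i : ℕ, ∃ θ,
      Real.cos θ = Real.sqrt (1 / (1 + Real.exp (-r) ^ 2 ^ i)) ∧
      Real.sin θ = Real.sqrt (Real.exp (-r) ^ 2 ^ i / (1 + Real.exp (-r) ^ 2 ^ i)) := by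
    intro i
    have hx : 0 < Real.exp (-r) ^ 2 ^ i := by positivity
    obtain ⟨θ, h1, h2⟩ := exists_angle (Real.sqrt (1 / (1 + Real.exp (-r) ^ 2 ^ i)))
      (Real.sqrt (Real.exp (-r) ^ 2 ^ i / (1 + Real.exp (-r) ^ 2 ^ i)))
    -- The two digit probabilities add up to 1, so the radius in `exists_angle` is 1.
    rw [Real.sq_sqrt (by positivity), Real.sq_sqrt (by positivity), ← add_div,
      div_self (by positivity), Real.sqrt_one, one_mul] at h1 h2
    exact ⟨θ, h1, h2⟩
  choose θ hcos hsin using h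
  refine ⟨θ, fun t ht => ?_⟩
  have hf : ∀ i, (if t.testBit i then Real.sin (θ i) else Real.cos (θ i)) =
      Real.sqrt ((if t.testBit i then Real.exp (-r) ^ 2 ^ i else 1) /
        (1 + Real.exp (-r) ^ 2 ^ i)) := by
    intro i
    split_ifs
    · exact hsin i
    · exact hcos i
  simp only [hf]
  rw [Real.sqrt_eq_iff_mul_self_eq, ← Finset.prod_mul_distrib, sliceProb_two_pow hr m t ht]
  · refine Finset.prod_congr rfl fun i _ => (Real.mul_self_sqrt ?_).symm
    split_ifs <;> positivity
  · exact sliceProb_nonneg hr (by positivity) t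
  · exact Finset.prod_nonneg fun i _ => Real.sqrt_nonneg _

end Slices

/-! ### The circuit of a single piece -/

section Piece

variable {Q : Type*} [Fintype Q] [DecidableEq Q] {s m : ℕ}

theorem exists_prepare_state {r : Fin s → Q} (hr : r.Injective) (K : Finset Q)
    (hK : ∀ q ∈ K, ∀ i, r i ≠ q) (c : Q → Bool) {S : ℕ} (hS : S ≤ 2 ^ s) (β : Fin S → ℝ)
    (hβ : ∀ k, 0 ≤ β k) (hsum : ∑ k, β k ^ 2 = 1) :
    ∃ gs : List (Gate Q), gs.length = S - 1 ∧ ControlledBy K c gs ∧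
      ∀ b : Q → Bool, (∀ q ∈ K, b q = c q) → (∀ i, b (r i) = false) →
        runGates gs (ket b) = ∑ k, (β k : ℂ) • ket (writeReg r k b) := by
  obtain ⟨p, rfl⟩ : ∃ p, S = p + 1 := by
    cases S with
    | zero => simp at hsum
    | succ p => exact ⟨p, rfl⟩
  set β' : ℕ → ℝ := fun k => if h : k < p + 1 then β ⟨k, h⟩ else 0 with hβ'
  have hval : ∀ k : Fin (p + 1), β' k = β k := fun k => dif_pos k.2
  obtain ⟨gs, hlen, hctl, hrun⟩ := exists_prepare_range hr K hK c p hS β' (by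
    intro k
    simp only [hβ']
    split_ifs
    · exact hβ _
    · exact le_rfl)
  refine ⟨gs, hlen, hctl, fun b hb h0 => ?_⟩
  have := hrun b hb
  simp only [Finset.sum_range, hval, hsum, Real.sqrt_one, Complex.ofReal_one, one_smul,
    writeReg_zero hr h0] at this
  exact this

/-- The circuit of one piece: the state of the piece is prepared by rotations controlled by
`K`, its time slice by rotations controlled by the state. -/
theorem exists_piece {ι : Type*} {l : List ι} (hl : l.Nodup) {K : Finset Q} {c : ι → Q → Bool}
    (hc : ∀ i ∈ l, ∀ j ∈ l, i ≠ j → ∃ q ∈ K, c i q ≠ c j q)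
    {rs : Fin s → Q} (hrs : rs.Injective) {rt : Fin m → Q} (hrt : rt.Injective)
    (hst : ∀ i j, rt j ≠ rs i) (hK : ∀ q ∈ K, ∀ i, rs i ≠ q)
    {S : ℕ} (hS : S ≤ 2 ^ s) {β : ι → Fin S → ℝ} (hβ : ∀ i k, 0 ≤ β i k)
    (hsum : ∀ i, ∑ k, β i k ^ 2 = 1) {ρ : Fin S → ℝ} (hρ : ∀ k, 0 < ρ k) :
    ∃ Ls : List (List (Gate Q)), (∀ L ∈ Ls, L.Pairwise Gate.Compatible) ∧
      Ls.length = l.length * (S - 1) + S ∧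
      (Ls.map List.length).sum = l.length * (S - 1) + S * m ∧
      ∀ i ∈ l, ∀ b : Q → Bool, (∀ q ∈ K, b q = c i q) → (∀ j, b (rs j) = false) →
        (∀ j, b (rt j) = false) →
        runGates Ls.flatten (ket b) = ∑ k : Fin S, ∑ t : Fin (2 ^ m),
          ((β i k * Real.sqrt (sliceProb (ρ k) (2 ^ m) t) : ℝ) : ℂ) •
            ket (writeReg rt t (writeReg rs k b)) := by
  choose G hGlen hGctl hGrun using fun i =>
    exists_prepare_state hrs K hK (c i) hS (β i) (hβ i) (hsum i)
  choose θ hθ using fun k => exists_slice_angles (hρ k) m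
  have hst' : ∀ q ∈ Finset.univ.image rs, ∀ j, rt j ≠ q := by
    intro q hq j
    obtain ⟨i, -, rfl⟩ := Finset.mem_image.1 hq
    exact hst i j
  -- The exit rate depends on the current state, so the time rotations are controlled by the state
  -- register of the same piece, with one layer per state.
  choose T hTlen hTcomp hTgate hTrun using fun k : Fin S =>
    exists_prepare_bits hrt (Finset.univ.image rs) hst'
      (writeReg rs k fun _ => false) (θ k) m le_rfl
  have hTctl : ∀ k : Fin S, ControlledBy (Finset.univ.image rs)
      (writeReg rs k fun _ => false) (T k) := by
    intro k g hg b ⟨q, hq, hne⟩ hf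
    obtain ⟨h1, h2, -⟩ := hTgate k g hg
    exact hne (by rw [← h2]; exact hf q (by rw [h1]; exact hq))
  have hflat : ((l.flatMap G).map (fun g => [g]) ++ (List.finRange S).map T).flatten =
      l.flatMap G ++ (List.finRange S).flatMap T := by
    rw [List.flatten_append, ← List.flatMap_def, ← List.flatMap_def, List.flatMap_singleton']
  have hlenG : (l.flatMap G).length = l.length * (S - 1) := by
    simp [List.length_flatMap, hGlen]
  refine ⟨(l.flatMap G).map (fun g => [g]) ++ (List.finRange S).map T, ?_, ?_, ?_, ?_⟩
  · intro L hL
    rcases List.mem_append.1 hL with h | h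
    · obtain ⟨g, -, rfl⟩ := List.mem_map.1 h
      exact List.pairwise_singleton _ _
    · obtain ⟨k, -, rfl⟩ := List.mem_map.1 h
      exact hTcomp k
  · rw [List.length_append, List.length_map, hlenG]
    simp
  · rw [← List.length_flatten, hflat, List.length_append, hlenG]
    simp [List.length_flatMap, hTlen]
  · intro i hi b hb hs0 ht0
    have hKw : ∀ k : ℕ, ∀ q ∈ K, writeReg rs k b q = c i q := fun k q hq => by
      rw [writeReg_of_notMem (hK q hq), hb q hq]
    rw [hflat, runGates_append, runGates_flatMap_of_mem hGctl hl hc hi hb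
      (hGrun i b hb hs0) (fun k => hKw k), map_sum]
    refine Finset.sum_congr rfl fun k _ => ?_
    have hmatch : ∀ b' : Q → Bool, (∀ q ∈ Finset.univ.image rs, b' q = writeReg rs k b q) →
        ∀ q ∈ Finset.univ.image rs, b' q = writeReg rs k (fun _ => false) q := by
      intro b' hb' q hq
      rw [hb' q hq]
      obtain ⟨j, -, rfl⟩ := Finset.mem_image.1 hq
      rw [writeReg_apply hrs, writeReg_apply hrs]
    have ht0' : ∀ j, writeReg rs k b (rt j) = false := fun j => by
      rw [writeReg_of_notMem fun i => (hst i j).symm, ht0]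
    have hrun := hTrun k (writeReg rs k b) (hmatch _ fun _ _ => rfl)
    rw [writeReg_zero hrt ht0'] at hrun
    rw [map_smul, runGates_flatMap_of_mem hTctl (List.nodup_finRange S) ?_ (List.mem_finRange k)
      (hmatch _ fun _ _ => rfl) hrun ?_]
    · rw [Finset.sum_range, Finset.smul_sum]
      refine Finset.sum_congr rfl fun t _ => ?_
      rw [hθ k t t.2, smul_smul, Complex.ofReal_mul]
    · intro k _ k' _ hne
      obtain ⟨j, hj⟩ := exists_testBit_ne (k.2.trans_le hS) (k'.2.trans_le hS)
        (Fin.val_ne_of_ne hne)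
      exact ⟨rs j, by simp, by rwa [writeReg_apply hrs, writeReg_apply hrs]⟩
    · exact fun t => hmatch _ fun q hq => writeReg_of_notMem (hst' q hq) _ _

end Piece

/-! ### Composing the pieces -/

section Stages

theorem sum_snoc {Z M : Type*} [Fintype Z] [AddCommMonoid M] (j : ℕ) (F : (Fin (j + 1) → Z) → M) :
    ∑ z, F z = ∑ z : Fin j → Z, ∑ y, F (Fin.snoc z y) := by
  rw [← (Fin.snocEquiv fun _ => Z).sum_comp, Fintype.sum_prod_type_right]
  rfl

/-- The last entry of a sequence, if there is one. -/
def lastEntry {Z : Type*} {j : ℕ} (z : Fin j → Z) : Option Z :=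
  if h : j = 0 then none else some (z ⟨j - 1, by omega⟩)

theorem previous_snoc_castSucc {Z : Type*} {j : ℕ} (z : Fin j → Z) (y : Z) (i : Fin j) :
    previous (Fin.snoc z y : Fin (j + 1) → Z) i.castSucc = previous z i := by
  unfold previous
  by_cases h : (i : ℕ) = 0
  · simp [h]
  · have : (i : ℕ) - 1 < j := by omega
    simp [h, Fin.snoc, this]

theorem previous_snoc_last {Z : Type*} {j : ℕ} (z : Fin j → Z) (y : Z) :
    previous (Fin.snoc z y : Fin (j + 1) → Z) (Fin.last j) = lastEntry z := by
  unfold previous lastEntry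
  by_cases h : j = 0
  · simp [h]
  · have : j - 1 < j := by omega
    simp [h, Fin.snoc, this]

theorem prod_snoc {Z : Type*} {j : ℕ} (w : Option Z → Z → ℝ) (z : Fin j → Z) (y : Z) :
    ∏ i, w (previous (Fin.snoc z y : Fin (j + 1) → Z) i) ((Fin.snoc z y : Fin (j + 1) → Z) i) =
      (∏ i, w (previous z i) (z i)) * w (lastEntry z) y := by
  rw [Fin.prod_univ_castSucc, previous_snoc_last, Fin.snoc_last]
  simp only [previous_snoc_castSucc, Fin.snoc_castSucc]

theorem sum_prod_previous {Z : Type*} [Fintype Z] {w : Option Z → Z → ℝ}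
    (hw : ∀ o, ∑ y, w o y = 1) (j : ℕ) : ∑ z : Fin j → Z, ∏ i, w (previous z i) (z i) = 1 := by
  induction j with
  | zero => simp
  | succ j ih => simp only [sum_snoc, prod_snoc, ← Finset.mul_sum, hw, mul_one, ih]

variable {S n s m : ℕ}

/-- The bit string of a sequence of `j` pieces, the later pieces being zero. -/
def stageBits (n s : ℕ) {j : ℕ} (z : Fin j → Fin S × Fin (2 ^ m)) : Qubits n s m → Bool
  | (i, Sum.inl a) => if h : (i : ℕ) < j then ((z ⟨i, h⟩).1 : ℕ).testBit a else false
  | (i, Sum.inr a) => if h : (i : ℕ) < j then ((z ⟨i, h⟩).2 : ℕ).testBit a else false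

/-- The state qubits of the `i`-th piece. -/
def stateReg (s m : ℕ) (i : Fin n) (a : Fin s) : Qubits n s m := (i, Sum.inl a)

/-- The time qubits of the `i`-th piece. -/
def timeReg (s m : ℕ) (i : Fin n) (a : Fin m) : Qubits n s m := (i, Sum.inr a)

theorem stateReg_injective (i : Fin n) : (stateReg s m i).Injective :=
  fun a b h => by simpa [stateReg] using h

theorem timeReg_injective (i : Fin n) : (timeReg s m i).Injective :=
  fun a b h => by simpa [timeReg] using h

theorem writeReg_stageBits (i : Fin n) (z : Fin i → Fin S × Fin (2 ^ m)) (k : Fin S)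
    (t : Fin (2 ^ m)) :
    writeReg (timeReg s m i) t (writeReg (stateReg s m i) k (stageBits n s z)) =
      stageBits n s (Fin.snoc z (k, t) : Fin (i + 1) → Fin S × Fin (2 ^ m)) := by
  funext ⟨i', a⟩
  rcases eq_or_ne i' i with rfl | hne
  · rcases a with a | a
    · rw [writeReg_of_notMem (by simp [timeReg])]
      exact (writeReg_apply (stateReg_injective _) _ _ _).trans (by simp [stageBits, Fin.snoc])
    · exact (writeReg_apply (timeReg_injective _) _ _ _).trans (by simp [stageBits, Fin.snoc])
  · rw [writeReg_of_notMem (by simp [timeReg, hne.symm]),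
      writeReg_of_notMem (by simp [stateReg, hne.symm])]
    rcases lt_or_ge (i' : ℕ) i with h | h
    · have h' : (i' : ℕ) < i + 1 := h.trans (Nat.lt_succ_self _)
      rcases a with a | a <;> simp [stageBits, h, h', Fin.snoc]
    · have h' : ¬ (i' : ℕ) < i + 1 := by
        have := Fin.val_ne_of_ne hne
        omega
      rcases a with a | a <;> simp [stageBits, h.not_gt, h']

/-- The amplitude of a piece given the state of the previous one. -/
def pieceWeight (α : Option (Fin S) → Fin S → ℝ) (ρ : Fin S → ℝ) (m : ℕ)
    (o : Option (Fin S × Fin (2 ^ m))) (y : Fin S × Fin (2 ^ m)) : ℝ :=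
  Real.sqrt (α (o.map Prod.fst) y.1) * Real.sqrt (sliceProb (ρ y.1) (2 ^ m) y.2)

variable {α : Option (Fin S) → Fin S → ℝ} {ρ : Fin S → ℝ}

/-- The controls are the state qubits of the previous piece, one pattern per previous state. The
first piece has no predecessor: its control set is empty and a single block suffices. -/
theorem exists_stage_step (hS1 : 1 ≤ S) (hS : S ≤ 2 ^ s) (hα : ∀ o k, 0 ≤ α o k)
    (hsum : ∀ o, ∑ k, α o k = 1) (hρ : ∀ k, 0 < ρ k) (i : Fin n) :
    ∃ Ls : List (List (Gate (Qubits n s m))), (∀ L ∈ Ls, L.Pairwise Gate.Compatible) ∧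
      Ls.length ≤ S ^ 2 ∧ (Ls.map List.length).sum ≤ S * (S + m) ∧
      ∀ z : Fin i → Fin S × Fin (2 ^ m), runGates Ls.flatten (ket (stageBits n s z)) =
        ∑ y, (pieceWeight α ρ m (lastEntry z) y : ℂ) •
          ket (stageBits n s (Fin.snoc z y : Fin (i + 1) → Fin S × Fin (2 ^ m))) := by
  have hst : ∀ a b, timeReg s m i b ≠ stateReg s m i a := fun a b => by simp [timeReg, stateReg]
  have hsq : ∀ o, ∑ k, Real.sqrt (α o k) ^ 2 = 1 := fun o => by
    simp only [Real.sq_sqrt (hα _ _), hsum]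
  have hs0 : ∀ (z : Fin i → Fin S × Fin (2 ^ m)) j, stageBits n s z (stateReg s m i j) = false :=
    fun z j => by simp [stageBits, stateReg]
  have ht0 : ∀ (z : Fin i → Fin S × Fin (2 ^ m)) j, stageBits n s z (timeReg s m i j) = false :=
    fun z j => by simp [stageBits, timeReg]
  obtain ⟨p, rfl⟩ : ∃ p, S = p + 1 := ⟨S - 1, by omega⟩
  by_cases hi : (i : ℕ) = 0
  · obtain ⟨Ls, hcomp, hlen, hcount, hrun⟩ := exists_piece (l := [()]) (List.nodup_singleton _)
      (K := (∅ : Finset (Qubits n s m))) (c := fun _ _ => false) (by simp)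
      (stateReg_injective i) (timeReg_injective i) hst (by simp) hS
      (β := fun _ k => Real.sqrt (α none k)) (fun _ _ => Real.sqrt_nonneg _) (fun _ => hsq none) hρ
    refine ⟨Ls, hcomp, ?_, ?_, fun z => ?_⟩
    -- Here the depth is only 2S - 1, which is at most S².
    · rw [hlen]; simp; nlinarith
    · rw [hcount]; simp; nlinarith
    · rw [hrun () (by simp) _ (by simp) (hs0 z) (ht0 z), Fintype.sum_prod_type]
      simp [pieceWeight, lastEntry, hi, writeReg_stageBits]
  · set i' : Fin n := ⟨i - 1, by omega⟩ with hi'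
    have hinj := stateReg_injective (s := s) (m := m) i'
    obtain ⟨Ls, hcomp, hlen, hcount, hrun⟩ := exists_piece (l := List.finRange (p + 1))
      (List.nodup_finRange _) (K := Finset.univ.image (stateReg s m i'))
      (c := fun k => writeReg (stateReg s m i') k fun _ => false)
      (by
        intro k _ k' _ hne
        obtain ⟨j, hj⟩ := exists_testBit_ne (k.2.trans_le hS) (k'.2.trans_le hS)
          (Fin.val_ne_of_ne hne)
        exact ⟨stateReg s m i' j, by simp, by rwa [writeReg_apply hinj, writeReg_apply hinj]⟩)
      (stateReg_injective i) (timeReg_injective i) hst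
      (by
        have : i ≠ i' := fun h => by
          have := congrArg Fin.val h
          simp only [hi'] at this
          omega
        simp [stateReg, this]) hS
      (β := fun o k => Real.sqrt (α (some o) k)) (fun _ _ => Real.sqrt_nonneg _)
      (fun o => hsq (some o)) hρ
    refine ⟨Ls, hcomp, ?_, ?_, fun z => ?_⟩
    · rw [hlen]; simp; nlinarith
    · rw [hcount]; simp; nlinarith
    · rw [hrun (z ⟨i - 1, by omega⟩).1 (List.mem_finRange _) _ ?_ (hs0 z) (ht0 z),
        Fintype.sum_prod_type]
      · simp [pieceWeight, lastEntry, hi, writeReg_stageBits]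
      · intro q hq
        obtain ⟨j, -, rfl⟩ := Finset.mem_image.1 hq
        rw [writeReg_apply hinj]
        have : (i : ℕ) - 1 < i := by omega
        simp [stateReg, stageBits, hi', this]

theorem exists_stage (hS1 : 1 ≤ S) (hS : S ≤ 2 ^ s) (hα : ∀ o k, 0 ≤ α o k)
    (hsum : ∀ o, ∑ k, α o k = 1) (hρ : ∀ k, 0 < ρ k) (j : ℕ) (hj : j ≤ n) :
    ∃ Ls : List (List (Gate (Qubits n s m))), (∀ L ∈ Ls, L.Pairwise Gate.Compatible) ∧
      Ls.length ≤ j * S ^ 2 ∧ (Ls.map List.length).sum ≤ j * (S * (S + m)) ∧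
      runGates Ls.flatten (ket fun _ => false) = ∑ z : Fin j → Fin S × Fin (2 ^ m),
        ((∏ i, pieceWeight α ρ m (previous z i) (z i) : ℝ) : ℂ) • ket (stageBits n s z) := by
  induction j with
  | zero =>
    refine ⟨[], by simp, by simp, by simp, ?_⟩
    have : stageBits n s (default : Fin 0 → Fin S × Fin (2 ^ m)) = fun _ => false := by
      funext ⟨i, a⟩
      rcases a with a | a <;> simp [stageBits]
    simp [runGates, this]
  | succ j ih =>
    obtain ⟨Ls, hcomp, hlen, hcount, hrun⟩ := ih (Nat.le_of_succ_le hj)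
    obtain ⟨Ls', hcomp', hlen', hcount', hrun'⟩ :=
      exists_stage_step (m := m) hS1 hS hα hsum hρ (⟨j, hj⟩ : Fin n)
    refine ⟨Ls ++ Ls', ?_, ?_, ?_, ?_⟩
    · intro L hL
      exact (List.mem_append.1 hL).elim (hcomp L) (hcomp' L)
    · rw [List.length_append, add_mul, one_mul]
      exact add_le_add hlen hlen'
    · rw [List.map_append, List.sum_append, add_mul, one_mul]
      exact add_le_add hcount hcount'
    · rw [List.flatten_append, runGates_append, hrun, map_sum, sum_snoc]
      refine Finset.sum_congr rfl fun z _ => ?_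
      rw [map_smul, hrun' z, Finset.smul_sum]
      refine Finset.sum_congr rfl fun y _ => ?_
      rw [prod_snoc, smul_smul, Complex.ofReal_mul]

end Stages

/-! ### Normalization and qubit counts -/

section Assembly

theorem previous_map {Y Z : Type*} {n : ℕ} (f : Y → Z) (z : Fin n → Y) (j : Fin n) :
    previous (fun i => f (z i)) j = (previous z j).map f := by
  unfold previous
  split_ifs <;> rfl

theorem sum_arrow_prod {n : ℕ} {Y Z M : Type*} [Fintype Y] [Fintype Z] [AddCommMonoid M]
    (F : (Fin n → Y × Z) → M) :
    ∑ k : Fin n → Y, ∑ t : Fin n → Z, F (fun i => (k i, t i)) = ∑ z, F z := by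
  rw [← Fintype.sum_prod_type', ← (Equiv.arrowProdEquivProdArrow (Fin n) (fun _ => Y)
    (fun _ => Z)).symm.sum_comp]
  rfl

theorem entryProb_nonneg {Ω E : Type*} [MeasurableSpace Ω] [Fintype E] [DecidableEq E]
    {μ : Measure Ω} {P : ℝ≥0 → Matrix E E ℝ} {X : ℝ≥0 → Ω → E} (hP : IsTransitionFunction P)
    (o : Option E) (l : E) : 0 ≤ entryProb μ P X o l := by
  cases o with
  | none => exact measureReal_nonneg
  | some k => exact jumpProb_nonneg hP k l

theorem sum_entryProb {Ω E : Type*} [MeasurableSpace Ω] [Fintype E] [DecidableEq E]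
    [MeasurableSpace E] [MeasurableSingletonClass E] {μ : Measure Ω} [IsProbabilityMeasure μ]
    {P : ℝ≥0 → Matrix E E ℝ} {X : ℝ≥0 → Ω → E} (hX : Measurable (X 0))
    (hP : IsTransitionFunction P) (hr : ∀ k, 0 < exitRate P k) (o : Option E) :
    ∑ l, entryProb μ P X o l = 1 := by
  cases o with
  | none => simpa [entryProb] using sum_real_inter_fiber (μ := μ) hX Set.univ
  | some k => exact sum_jumpProb hP (hr k)

theorem le_two_pow_stateQubits (S : ℕ) : S ≤ 2 ^ stateQubits S := by
  rcases Nat.eq_zero_or_pos S with rfl | h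
  · simp
  · have hS : (0 : ℝ) < S := by exact_mod_cast h
    have : Real.logb 2 S ≤ stateQubits S := Nat.le_ceil _
    rw [Real.logb_le_iff_le_rpow one_lt_two hS, Real.rpow_natCast] at this
    exact_mod_cast this

theorem neg_log_div_le_two_pow_timeQubits {lam ε : ℝ} (hlam : 0 < lam) (hε : 0 < ε)
    (hε1 : ε < 1) : -(1 / lam) * Real.log ε ≤ 2 ^ timeQubits lam ε := by
  have hpos : 0 < -(1 / lam) * Real.log ε :=
    mul_pos_of_neg_of_neg (by simpa using hlam) (Real.log_neg hε hε1)
  have := Nat.le_ceil (Real.logb 2 (-(1 / lam) * Real.log ε))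
  rwa [Real.logb_le_iff_le_rpow one_lt_two hpos, Real.rpow_natCast] at this

/-- The hypothesis on `ε` says that -ln ε / lam ≥ 1, so its logarithm is nonnegative and the
natural-number ceiling does not truncate it at 0. -/
theorem logb_mul_split {lam ε : ℝ} (hlam : 0 < lam) (h : ε ≤ Real.exp (-lam))
    (hε : 0 < ε) {S : ℕ} (hS : 0 < S) :
    0 ≤ Real.logb 2 (-(1 / lam) * Real.log ε) ∧
      Real.logb 2 (-(S / lam) * Real.log ε) =
        Real.logb 2 S + Real.logb 2 (-(1 / lam) * Real.log ε) := by
  have h1 : 1 ≤ -(1 / lam) * Real.log ε := by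
    have := (Real.log_le_iff_le_exp hε).2 h
    rw [neg_mul, one_div, ← mul_neg, inv_mul_eq_div, le_div_iff₀ hlam]
    linarith
  have hS' : (S : ℝ) ≠ 0 := by exact_mod_cast hS.ne'
  refine ⟨Real.logb_nonneg one_lt_two h1, ?_⟩
  rw [← Real.logb_mul hS' (by linarith)]
  congr 1
  ring

theorem stateQubits_add_timeQubits_le {lam ε : ℝ} (hlam : 0 < lam) (h : ε ≤ Real.exp (-lam))
    (hε : 0 < ε) {S : ℕ} (hS : 0 < S) :
    stateQubits S + timeQubits lam ε ≤ ⌈Real.logb 2 (-(S / lam) * Real.log ε)⌉₊ + 1 := by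
  obtain ⟨h0, h1⟩ := logb_mul_split hlam h hε hS
  have hS0 : 0 ≤ Real.logb 2 S := Real.logb_nonneg one_lt_two (by exact_mod_cast hS)
  rw [h1, stateQubits, timeQubits]
  have a1 := Nat.ceil_lt_add_one hS0
  have a2 := Nat.ceil_lt_add_one h0
  have a3 := Nat.le_ceil (Real.logb 2 S + Real.logb 2 (-(1 / lam) * Real.log ε))
  have : ((⌈Real.logb 2 S⌉₊ + ⌈Real.logb 2 (-(1 / lam) * Real.log ε)⌉₊ : ℕ) : ℝ) <
      ((⌈Real.logb 2 S + Real.logb 2 (-(1 / lam) * Real.log ε)⌉₊ + 2 : ℕ) : ℝ) := by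
    push_cast
    linarith
  have := Nat.cast_lt.1 this
  omega

theorem stateQubits_two_pow_add_timeQubits {lam ε : ℝ} (hlam : 0 < lam)
    (h : ε ≤ Real.exp (-lam)) (hε : 0 < ε) (r : ℕ) :
    stateQubits (2 ^ r) + timeQubits lam ε =
      ⌈Real.logb 2 (-(((2 ^ r : ℕ) : ℝ) / lam) * Real.log ε)⌉₊ := by
  obtain ⟨h0, h1⟩ := logb_mul_split hlam h hε (S := 2 ^ r) (by positivity)
  have hr : Real.logb 2 ((2 ^ r : ℕ) : ℝ) = r := by
    rw [Nat.cast_pow, Nat.cast_ofNat, ← Real.rpow_natCast,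
      Real.logb_rpow two_pos (by norm_num)]
  rw [h1, stateQubits, hr, timeQubits, Nat.ceil_natCast, add_comm (r : ℝ), Nat.ceil_add_natCast h0,
    add_comm]

end Assembly

end QCTSP

end

/-! ### The main theorem -/

theorem mainTheorem5 :
    ∃ C : ℝ, 0 < C ∧
      ∀ {Ω : Type*} [MeasurableSpace Ω] (μ : Measure Ω) [IsProbabilityMeasure μ]
        (E : Finset ℤ) (P : ℝ≥0 → Matrix E E ℝ) (X : ℝ≥0 → Ω → E)
        (_ : QCTSP.IsMarkovChain μ P X) (lam : ℝ) (_ : lam = QCTSP.minRate P) (_ : 0 < lam)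
        (ε : ℝ) (_ : 0 < ε) (_ : ε < 1) (n S : ℕ) (x : Fin S ≃ E)
        (s m : ℕ) (_ : s = QCTSP.stateQubits S) (_ : m = QCTSP.timeQubits lam ε),
        -- the rates are those of the holding times
        (∀ (j : Fin n) (k : E), μ (QCTSP.stateEvent X j k) ≠ 0 → ∀ t : ℝ≥0,
          (ProbabilityTheory.cond μ (QCTSP.stateEvent X j k)).real
            {ω | (t : ℝ≥0∞) ≤ QCTSP.holdingTime (fun u => X u ω) j} =
              Real.exp (-QCTSP.exitRate P k * t)) ∧
        -- truncating the holding times at `2 ^ m` has error at most `ε`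
        (∀ (j : Fin n) (k : E),
          (ProbabilityTheory.cond μ (QCTSP.stateEvent X j k)).real
            (QCTSP.truncEvent X j (2 ^ m))ᶜ ≤ ε) ∧
        -- the amplitudes are normalized
        (∑ k : Fin n → Fin S, ∑ t : Fin n → Fin (2 ^ m),
          QCTSP.amplitude μ X (2 ^ m) (fun j => x (k j)) (fun j => (t j : ℕ)) ^ 2 = 1) ∧
        -- the number of qubits
        Fintype.card (QCTSP.Qubits n s m) =
          n * QCTSP.stateQubits S + n * QCTSP.timeQubits lam ε ∧
        (ε ≤ Real.exp (-lam) →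
          Fintype.card (QCTSP.Qubits n s m) ≤
            n * (⌈Real.logb 2 (-(S / lam) * Real.log ε)⌉₊ + 1)) ∧
        (ε ≤ Real.exp (-lam) → (∃ r : ℕ, S = 2 ^ r) →
          Fintype.card (QCTSP.Qubits n s m) =
            n * ⌈Real.logb 2 (-(S / lam) * Real.log ε)⌉₊) ∧
        -- the circuit
        ∃ c : QCTSP.Circuit (QCTSP.Qubits n s m),
          c.unitary.val *ᵥ QCTSP.ket (fun _ => false) = QCTSP.targetState μ X x n s m ∧
          (c.gateCount : ℝ) ≤ C * (n * S * (S + QCTSP.timeQubits lam ε)) ∧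
          c.depth ≤ n * S ^ 2 := by

  refine ⟨1, one_pos, ?_⟩
  intro Ω _ μ _ E P X hX lam hlam hlam0 ε hε hε1 n S x s m hs hm
  have hM := hX.hasMarkovLaw
  have hP := hX.transitionFunction
  have hle : ∀ k, lam ≤ QCTSP.exitRate P k := fun k => by
    rw [hlam]
    exact ciInf_le (Set.finite_range _).bddBelow k
  have hr : ∀ k, 0 < QCTSP.exitRate P k := fun k => hlam0.trans_le (hle k)
  -- A probability space is nonempty, so the chain occupies some state.
  have hS0 : 0 < S := by
    obtain ⟨ω⟩ := μ.nonempty_of_neZero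
    exact (x.symm (X 0 ω)).pos
  have hcard : Fintype.card (QCTSP.Qubits n s m) =
      n * (QCTSP.stateQubits S + QCTSP.timeQubits lam ε) := by
    simp [QCTSP.Qubits, hs, hm]
  have hS : S ≤ 2 ^ s := hs ▸ QCTSP.le_two_pow_stateQubits S
  set α : Option (Fin S) → Fin S → ℝ := fun o k => QCTSP.entryProb μ P X (o.map x) (x k) with hα
  set ρ : Fin S → ℝ := fun k => QCTSP.exitRate P (x k) with hρ
  have hα0 : ∀ o k, 0 ≤ α o k := fun o k => QCTSP.entryProb_nonneg hP _ _
  have hα1 : ∀ o, ∑ k, α o k = 1 := fun o =>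
    (x.sum_comp fun l => QCTSP.entryProb μ P X (o.map x) l).trans
      (QCTSP.sum_entryProb (hX.measurable 0) hP hr _)
  have hρ0 : ∀ k, 0 < ρ k := fun k => hr _
  have hamp : ∀ z : Fin n → Fin S × Fin (2 ^ m),
      QCTSP.amplitude μ X (2 ^ m) (fun j => x (z j).1) (fun j => ((z j).2 : ℕ)) =
        ∏ i, QCTSP.pieceWeight α ρ m (QCTSP.previous z i) (z i) := by
    intro z
    rw [hM.amplitude_eq hP hr _ _ fun j => (z j).2.2]
    refine Finset.prod_congr rfl fun j _ => ?_
    rw [QCTSP.previous_map (fun y : Fin S × Fin (2 ^ m) => x y.1) z j]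
    simp only [QCTSP.pieceWeight, hα, hρ, Option.map_map]
    rfl
  refine ⟨fun j k hk t => hM.cond_holdingTime hP hr j k hk t, ?_, ?_, ?_, ?_, ?_, ?_⟩
  · intro j k
    -- Conditioning on a null event gives the zero measure. Otherwise the tail is exp(-λ_k 2^m), and
    -- 2^m λ_k ≥ 2^m λ_min ≥ -ln ε.
    by_cases hk : μ (QCTSP.stateEvent X j k) = 0
    · rw [ProbabilityTheory.cond_eq_zero_of_meas_eq_zero hk]
      simpa using hε.le
    · have hset : (QCTSP.truncEvent X j (2 ^ m))ᶜ =
          {ω | (((2 ^ m : ℕ) : ℝ≥0) : ℝ≥0∞) ≤ QCTSP.holdingTime (fun u => X u ω) j} := by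
        ext ω
        simp [QCTSP.truncEvent]
      rw [hset, hM.cond_holdingTime hP hr j k hk, ← Real.le_log_iff_exp_le hε]
      have h1 := QCTSP.neg_log_div_le_two_pow_timeQubits hlam0 hε hε1
      rw [← hm, neg_mul, one_div, ← mul_neg, inv_mul_eq_div, div_le_iff₀ hlam0] at h1
      have h2 : 2 ^ m * lam ≤ 2 ^ m * QCTSP.exitRate P k :=
        mul_le_mul_of_nonneg_left (hle k) (by positivity)
      push_cast
      linarith
  · rw [QCTSP.sum_arrow_prod fun z : Fin n → Fin S × Fin (2 ^ m) =>
      QCTSP.amplitude μ X (2 ^ m) (fun j => x (z j).1) (fun j => ((z j).2 : ℕ)) ^ 2]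
    simp only [hamp, ← Finset.prod_pow]
    -- The squared weights are transition probabilities of a chain on pairs (state, slice), so the
    -- entries can be summed out from the last one backwards.
    refine QCTSP.sum_prod_previous (w := fun o y => QCTSP.pieceWeight α ρ m o y ^ 2)
      (fun o => ?_) n
    have hT : 0 < 2 ^ m := by positivity
    simp only [QCTSP.pieceWeight, mul_pow, Real.sq_sqrt (hα0 _ _),
      Real.sq_sqrt (QCTSP.sliceProb_nonneg (hρ0 _) hT _), Fintype.sum_prod_type,
      ← Finset.mul_sum, QCTSP.sum_sliceProb (hρ0 _) hT, mul_one, hα1]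
  · rw [hcard, mul_add]
  · intro h
    rw [hcard]
    exact Nat.mul_le_mul_left n (QCTSP.stateQubits_add_timeQubits_le hlam0 h hε hS0)
  · rintro h ⟨r, rfl⟩
    rw [hcard, QCTSP.stateQubits_two_pow_add_timeQubits hlam0 h hε]
  · obtain ⟨Ls, hcomp, hlen, hcount, hrun⟩ :=
      QCTSP.exists_stage (n := n) (m := m) hS0 hS hα0 hα1 hρ0 n le_rfl
    refine ⟨⟨Ls, hcomp⟩, ?_, ?_, hlen⟩
    · rw [QCTSP.Circuit.unitary_mulVec, hrun, QCTSP.targetState]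
      refine Eq.trans ?_ (QCTSP.sum_arrow_prod fun z : Fin n → Fin S × Fin (2 ^ m) =>
        ((QCTSP.amplitude μ X (2 ^ m) (fun j => x (z j).1) (fun j => ((z j).2 : ℕ)) : ℝ) : ℂ) •
          QCTSP.ket (QCTSP.encode s m (fun j => ((z j).1 : ℕ)) (fun j => ((z j).2 : ℕ)))).symm
      refine Finset.sum_congr rfl fun z _ => ?_
      rw [hamp]
      congr 2
      funext ⟨i, a⟩
      rcases a with a | a <;> simp [QCTSP.stageBits, QCTSP.encode]
    · rw [one_mul, ← hm, mul_assoc]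
      exact_mod_cast hcount
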